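/- Let $m\ge 1$ be an integer and let $p=(p_0,\dots,p_m)$ be a probability vector with $p_i>0$ for all $i$. The random noble means substitution $\zeta_m$ on words over $\{a,b\}$ replaces the letters of a word independently of each other: every $b$ is replaced by $a$, and every $a$ is replaced by $a^i b\,a^{m-i}$ with probability $p_i$ $(0\le i\le m)$. A word is an image of $w$ under $\zeta_m^k$ if it arises from $w$ by $k$ successive such replacements. A word is *legal* if it is a subword of at least one image of $b$ under $\zeta_m^k$ for some $k\ge1$; let $\mathcal D_{m,\ell}$ be the set of legal words of length $\ell$. Let $X_m\subset\{a,b\}^{\mathbb Z}$ be the set of accumulation points of the images of $a|a$ under $\zeta_m^k$, $k\ge 0$: here $x\in X_m$ if for all $N$ there are infinitely many $k$, and images $u,v$ of $a$ under $\zeta_m^k$ of length at least $N$, such that $x_{-N}\cdots x_{-1}$ is a suffix of $u$ and $x_0\cdots x_{N-1}$ is a prefix of $v$. The stochastic hull $\mathbb X_m$ is the smallest closed subset of $\{a,b\}^{\mathbb Z}$ (product topology) that contains $X_m$ and is invariant under the shift $(Sx)_i=x_{i+1}$, i.e. $S(\mathbb X_m)=\mathbb X_m$. For $\ell\ge1$,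 let $M_{m,\ell}$ be the substitution matrix of the induced substitution on $\mathcal D_{m,\ell}$: its entry at $(u,w)$ is the expected number of positions $k$ with $0\le k<|\zeta_m(w_0)|$ at which $u$ occurs in the random image $\zeta_m(w)$ of $w=w_0w_1\cdots w_{\ell-1}$, where $\zeta_m(w_0)$ is the part of this image that comes from the first letter. Let $\mathbf R_{m,\ell}$ be the right Perron–Frobenius eigenvector of $M_{m,\ell}$ (the positive eigenvector for its spectral radius), normalised so that its entries sum to $1$. Then there is exactly one Borel measure $\mu_m$ on $\mathbb X_m$ with $$\mu_m\bigl(\{x\in\mathbb X_m : x_k x_{k+1}\cdots x_{k+\ell-1}=w\}\bigr)=\mathbf R_{m,\ell}(w)\qquad\text{for all } \ell\ge1,\ w\in\mathcal D_{m,\ell},\ k\in\mathbb Z ;$$ it is an $S$-invariant probability measure, and for every $f\in L^1(\mathbb X_m,\mu_m)$ and every fixed $s\in\mathbb Z$, $$\lim_{n\to\infty}\frac1n\sum_{i=s}^{n+s-1} f(S^i x)=\int_{\mathbb X_m} f\,\mathrm d\mu_m\qquad\text{for } \mu_m\text{-almost every } x\in\mathbb X_m .$$ -/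

import Mathlib

open MeasureTheory Filter Topology

namespace RNMS

/-- The binary alphabet. -/
inductive Letter where
  | a
  | b
  deriving DecidableEq, Inhabited

instance : Fintype Letter where
  elems := {Letter.a, Letter.b}
  complete x := by cases x <;> simp

instance : TopologicalSpace Letter := ⊥
instance : DiscreteTopology Letter := ⟨rfl⟩
instance : MeasurableSpace Letter := ⊤
instance : DiscreteMeasurableSpace Letter := ⟨fun _ => trivial⟩

/-- The image of a letter when the `i`-th noble means substitution is chosen for it:
`a ↦ aⁱ b aᵐ⁻ⁱ`, `b ↦ a`. -/
def letterImage (m : ℕ) : Letter → Fin (m + 1) → List Letter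
  | Letter.a, i =>
      List.replicate (i : ℕ) Letter.a ++ Letter.b :: List.replicate (m - (i : ℕ)) Letter.a
  | Letter.b, _ => [Letter.a]

/-- The image of a word of length `ℓ` when the substitution with index `c i` is applied to its
`i`-th letter. The index chosen for a letter `b` is irrelevant. -/
def wordImage (m : ℕ) {ℓ : ℕ} (w : Fin ℓ → Letter) (c : Fin ℓ → Fin (m + 1)) : List Letter :=
  (List.ofFn fun i => letterImage m (w i) (c i)).flatten

/-- The set of all images of the word `w` under the random noble means substitution. -/
def images (m : ℕ) (w : List Letter) : Set (List Letter) :=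
  {v | ∃ c : Fin w.length → Fin (m + 1), v = wordImage m w.get c}

/-- The set of all images of the word `w` under the `k`-th power of the random noble means
substitution. -/
def iterImages (m : ℕ) : ℕ → List Letter → Set (List Letter)
  | 0, w => {w}
  | k + 1, w => {v | ∃ u ∈ iterImages m k w, v ∈ images m u}

/-- A word is legal if it is a subword of at least one image of `b` under some power. -/
def Legal (m : ℕ) (w : List Letter) : Prop :=
  ∃ k : ℕ, 1 ≤ k ∧ ∃ v ∈ iterImages m k [Letter.b], w <:+: v

/-- The legal words of length `ℓ`. -/
def LegalWord (m ℓ : ℕ) : Type :=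
  {w : Fin ℓ → Letter // Legal m (List.ofFn w)}

open Classical in
noncomputable instance (m ℓ : ℕ) : Fintype (LegalWord m ℓ) :=
  inferInstanceAs (Fintype {w : Fin ℓ → Letter // Legal m (List.ofFn w)})

instance (m ℓ : ℕ) : DecidableEq (LegalWord m ℓ) :=
  inferInstanceAs (DecidableEq {w : Fin ℓ → Letter // Legal m (List.ofFn w)})

/-- The substitution matrix of the induced substitution on legal words of length `ℓ`. The entry
at `(u, w)` is the expected number of `k` with `0 ≤ k < |ζ(w₀)|` such that the word of length `ℓ`
that starts at position `k` of the random image of `w` is `u`; the letters of `w` are substituted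
independently, each with choosing probabilities `p`. -/
noncomputable def inducedMatrix {m : ℕ} (p : Fin (m + 1) → ℝ) (ℓ : ℕ) [NeZero ℓ] :
    Matrix (LegalWord m ℓ) (LegalWord m ℓ) ℝ :=
  fun u w => ∑ c : Fin ℓ → Fin (m + 1), (∏ i, p (c i)) *
    (((Finset.range (letterImage m (w.1 0) (c 0)).length).filter fun k =>
      ((wordImage m w.1 c).drop k).take ℓ = List.ofFn u.1).card : ℝ)

/-- `R` is the statistically normalised right Perron–Frobenius eigenvector of `M`: an eigenvector
for the spectral radius of `M`, with positive entries that sum up to `1`. -/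
structure IsPerronVector {ι : Type*} [Fintype ι] [DecidableEq ι] (M : Matrix ι ι ℝ)
    (R : ι → ℝ) : Prop where
  eigen : M.mulVec R = (spectralRadius ℂ (M.map Complex.ofReal)).toReal • R
  pos : ∀ i, 0 < R i
  sum_eq_one : ∑ i, R i = 1

/-- The shift `(S x)ᵢ = xᵢ₊₁` on bi-infinite words. -/
def shift : Equiv.Perm (ℤ → Letter) where
  toFun x i := x (i + 1)
  invFun x i := x (i - 1)
  left_inv x := by funext i; simp
  right_inv x := by funext i; simp

/-- The generating words: accumulation points of the images of `a|a` under the powers of the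
random substitution. An image of `a|a` consists of an image `u` of the left letter, which ends at
position `-1`, and an image `v` of the right letter, which starts at position `0`. -/
def generatingWords (m : ℕ) : Set (ℤ → Letter) :=
  {x | ∀ N K : ℕ, ∃ k ≥ K, ∃ u ∈ iterImages m k [Letter.a], ∃ v ∈ iterImages m k [Letter.a],
    ∀ j < N, u.reverse[j]? = some (x (-1 - (j : ℤ))) ∧ v[j]? = some (x (j : ℤ))}

/-- The two-sided discrete stochastic hull: the smallest closed shift-invariant set of bi-infinite
words that contains all generating words. -/
def hull (m : ℕ) : Set (ℤ → Letter) :=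
  ⋂₀ {Y | IsClosed Y ∧ shift '' Y = Y ∧ generatingWords m ⊆ Y}

theorem mem_hull_iff_shift_mem_hull (m : ℕ) (x : ℤ → Letter) :
    x ∈ hull m ↔ shift x ∈ hull m := by
  have key : ∀ Y : Set (ℤ → Letter), shift '' Y = Y → (x ∈ Y ↔ shift x ∈ Y) := by
    intro Y hY
    constructor
    · intro h
      rw [← hY]
      exact ⟨x, h, rfl⟩
    · intro h
      rw [← hY] at h
      obtain ⟨y, hy, hxy⟩ := h
      exact shift.injective hxy ▸ hy
  simp only [hull, Set.mem_sInter]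
  exact forall₂_congr fun Y hY => key Y hY.2.1

/-- The shift on the hull. -/
def hullShift (m : ℕ) : Equiv.Perm (hull m) :=
  shift.subtypeEquiv (mem_hull_iff_shift_mem_hull m)

/-- The cylinder set of all elements of the hull in which the word `w` starts at position `k`. -/
def cylinder (m : ℕ) (k : ℤ) {ℓ : ℕ} (w : Fin ℓ → Letter) : Set (hull m) :=
  {x | ∀ i : Fin ℓ, x.1 (k + (i : ℕ)) = w i}

/-- The measure of each cylinder set of a legal word `w` of length `ℓ ≥ 1` is the entry at `w` of
the normalised right Perron–Frobenius eigenvector of the `ℓ`-th induced substitution matrix. -/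
def IsCylinderMeasure {m : ℕ} (p : Fin (m + 1) → ℝ) (μ : Measure (hull m)) : Prop :=
  ∀ (ℓ : ℕ) [NeZero ℓ], ∃ R : LegalWord m ℓ → ℝ, IsPerronVector (inducedMatrix p ℓ) R ∧
    ∀ (w : LegalWord m ℓ) (k : ℤ), μ (cylinder m k w.1) = ENNReal.ofReal (R w)

end RNMS

/-!
# The frequency measure of the random noble means substitution

The image of a letter under a power of the substitution has a deterministic length, and the images
of the two letters are tied together by `b ↦ a`. The expected number `c k` of occurrences of a word
in the image of `a` under the `k`-th power therefore satisfies `c (k + 2) = m c (k + 1) + c k` up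
to the bounded number of occurrences that overlap a boundary of two images. As the second root of
`x² = m x + 1` has modulus less than `1`, every word `u` has a frequency `R u` such that `c k` is
`R u` times the length of the image up to a bounded error (`IsLocal.exists_hasFreq`). All algebra
of these frequencies follows from their uniqueness: they add up to `1`, are consistent for words of
different lengths and positions (`wsum_freqVec_drop`), and solve the eigenvector equation of the
induced substitution for its inflation factor (`inducedMatrix_mulVec_freqVec`). Irreducibility of
the induced substitution makes them positive and identifies them with the Perron–Frobenius
eigenvector (`isPerronVector_freqVec`, `IsPerronVector.eq_freqVec`).

Consistency gives a measure on the hull with these cylinder values, as a cluster point of finite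
combinations of Dirac measures (`exists_probabilityMeasure`). It is unique since the cylinder sets
of legal words generate the Borel sets, and invariant since the cylinder values do not depend on
the position.

For ergodicity, the eigenvector equation says that a long window of a random element of the hull is
distributed like a window in the image of a legal word under the `k`-th power. Images of different
letters are independent, and their mean deviations from the frequency are bounded. Hence the number
of occurrences of a word in such a window concentrates around its expected value
(`iterExpect_deviation_sq_le`, `exists_wsum_windowDev_le`), so that an invariant set is independent
of every cylinder set and therefore of itself (`measure_inter_cylinder`). The convergence of the
averages is then the pointwise ergodic theorem (`ae_tendsto_birkhoffSum`), which is proved by the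
maximal ergodic argument.
-/

namespace RNMS

/-! ### Expectations of functions of the random image -/

variable {m : ℕ} (p : Fin (m + 1) → ℝ)

/-- The expectation of `f` at the random image of the word `w`, as a linear functional in `f`. -/
noncomputable def expect (w : List Letter) : (List Letter → ℝ) →ₗ[ℝ] ℝ :=
  ∑ c : Fin w.length → Fin (m + 1), (∏ i, p (c i)) • LinearMap.proj (wordImage m w.get c)

/-- The expectation of `f` at the random image of the word `w` under the `k`-th power of the
substitution. -/
noncomputable def iterExpect : ℕ → List Letter → (List Letter → ℝ) →ₗ[ℝ] ℝ
  | 0, w => LinearMap.proj w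
  | k + 1, w => ∑ c : Fin w.length → Fin (m + 1),
      (∏ i, p (c i)) • iterExpect k (wordImage m w.get c)

theorem expect_apply (w : List Letter) (f : List Letter → ℝ) :
    expect p w f = ∑ c : Fin w.length → Fin (m + 1), (∏ i, p (c i)) * f (wordImage m w.get c) := by
  simp [expect]

theorem expect_ofFn {n : ℕ} (w : Fin n → Letter) (f : List Letter → ℝ) :
    expect p (List.ofFn w) f = ∑ c : Fin n → Fin (m + 1), (∏ i, p (c i)) * f (wordImage m w c) := by
  rw [expect_apply]
  have h : (List.ofFn w).length = n := List.length_ofFn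
  refine Fintype.sum_equiv (Equiv.arrowCongr (finCongr h) (Equiv.refl _)) _ _ fun c => ?_
  congr 1
  · exact Fintype.prod_equiv (finCongr h) _ _ fun i => by simp [Equiv.arrowCongr]
  · congr 1
    simp only [wordImage]
    congr 1
    apply List.ext_get
    · simp
    · intro i h1 h2
      simp

@[simp]
theorem iterExpect_zero (w : List Letter) (f : List Letter → ℝ) : iterExpect p 0 w f = f w := rfl

theorem iterExpect_succ (k : ℕ) (w : List Letter) (f : List Letter → ℝ) :
    iterExpect p (k + 1) w f = expect p w fun z => iterExpect p k z f := by
  simp [iterExpect, expect_apply]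

theorem expect_nil (f : List Letter → ℝ) : expect p [] f = f [] := by
  rw [expect_apply]
  refine (Fintype.sum_eq_single (fun i => i.elim0) fun c hc => ?_).trans ?_
  · exact absurd (funext fun i => i.elim0) hc
  · simp [wordImage]

theorem expect_cons (x : Letter) (w : List Letter) (f : List Letter → ℝ) :
    expect p (x :: w) f = ∑ i, p i * expect p w fun v => f (letterImage m x i ++ v) := by
  simp only [expect_apply, Finset.mul_sum]
  rw [← Fintype.sum_prod_type']
  refine (Fintype.sum_equiv (Fin.consEquiv fun _ => Fin (m + 1)) _ _ fun c => ?_).symm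
  rw [← mul_assoc]
  congr 1
  · simp [Fin.consEquiv, Fin.prod_univ_succ]
  · congr 1
    simp [wordImage, Fin.consEquiv, List.ofFn_succ]

theorem expect_append (w₁ w₂ : List Letter) (f : List Letter → ℝ) :
    expect p (w₁ ++ w₂) f = expect p w₁ fun v₁ => expect p w₂ fun v₂ => f (v₁ ++ v₂) := by
  induction w₁ generalizing f with
  | nil => simp [expect_nil]
  | cons x w ih => simp [expect_cons, ih]

/-- Fubini: the expectation commutes with linear functionals. -/
theorem expect_comm (w : List Letter) (Λ : (List Letter → ℝ) →ₗ[ℝ] ℝ)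
    (h : List Letter → List Letter → ℝ) :
    expect p w (fun z => Λ (h z)) = Λ fun x => expect p w fun z => h z x := by
  have : (fun x => expect p w fun z => h z x) =
      ∑ c : Fin w.length → Fin (m + 1), (∏ i, p (c i)) • h (wordImage m w.get c) := by
    funext x
    simp [expect_apply]
  rw [this, map_sum, expect_apply]
  simp

/-- Images of different letters are independent. -/
theorem iterExpect_append (k : ℕ) (w₁ w₂ : List Letter) (f : List Letter → ℝ) :
    iterExpect p k (w₁ ++ w₂) f =
      iterExpect p k w₁ fun v₁ => iterExpect p k w₂ fun v₂ => f (v₁ ++ v₂) := by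
  induction k generalizing w₁ w₂ f with
  | zero => rfl
  | succ k ih =>
    simp only [iterExpect_succ, expect_append, ih]
    congr 1
    funext z₁
    rw [expect_comm p w₂ (iterExpect p k z₁)]

/-- The powers of the substitution may be composed in the other order. -/
theorem iterExpect_succ' (k : ℕ) (w : List Letter) (f : List Letter → ℝ) :
    iterExpect p (k + 1) w f = iterExpect p k w fun z => expect p z f := by
  induction k generalizing w with
  | zero => simp [iterExpect_succ]
  | succ k ih =>
    rw [iterExpect_succ]
    simp only [ih]
    rw [← iterExpect_succ]

/-- The powers of the substitution may start, rather than end, with a single step. -/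
theorem mem_iterImages_succ (k : ℕ) (w v : List Letter) :
    v ∈ iterImages m (k + 1) w ↔ ∃ u ∈ images m w, v ∈ iterImages m k u := by
  induction k generalizing v with
  | zero => simp [iterImages]
  | succ k ih =>
    constructor
    · rintro ⟨u, hu, hv⟩
      obtain ⟨x, hx, hux⟩ := (ih u).1 hu
      exact ⟨x, hx, u, hux, hv⟩
    · rintro ⟨x, hx, u, hux, hv⟩
      exact ⟨u, (ih u).2 ⟨x, hx, hux⟩, hv⟩

variable {p}

theorem expect_mono (hp : ∀ i, 0 ≤ p i) {w : List Letter} {f g : List Letter → ℝ}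
    (h : ∀ v ∈ images m w, f v ≤ g v) : expect p w f ≤ expect p w g := by
  simp only [expect_apply]
  exact Finset.sum_le_sum fun c _ =>
    mul_le_mul_of_nonneg_left (h _ ⟨c, rfl⟩) (Finset.prod_nonneg fun i _ => hp _)

theorem iterExpect_mono (hp : ∀ i, 0 ≤ p i) {k : ℕ} {w : List Letter} {f g : List Letter → ℝ}
    (h : ∀ v ∈ iterImages m k w, f v ≤ g v) : iterExpect p k w f ≤ iterExpect p k w g := by
  induction k generalizing w with
  | zero => exact h w rfl
  | succ k ih =>
    simp only [iterExpect_succ]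
    exact expect_mono hp fun u hu => ih fun v hv => h v ((mem_iterImages_succ k w v).2 ⟨u, hu, hv⟩)

theorem expect_congr (hp : ∀ i, 0 ≤ p i) {w : List Letter} {f g : List Letter → ℝ}
    (h : ∀ v ∈ images m w, f v = g v) : expect p w f = expect p w g :=
  le_antisymm (expect_mono hp fun v hv => (h v hv).le) (expect_mono hp fun v hv => (h v hv).ge)

theorem iterExpect_congr (hp : ∀ i, 0 ≤ p i) {k : ℕ} {w : List Letter} {f g : List Letter → ℝ}
    (h : ∀ v ∈ iterImages m k w, f v = g v) : iterExpect p k w f = iterExpect p k w g :=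
  le_antisymm (iterExpect_mono hp fun v hv => (h v hv).le)
    (iterExpect_mono hp fun v hv => (h v hv).ge)

theorem expect_const (hsum : ∑ i, p i = 1) (w : List Letter) (r : ℝ) :
    expect p w (fun _ => r) = r := by
  induction w with
  | nil => simp [expect_nil]
  | cons x w ih => simp [expect_cons, ih, ← Finset.sum_mul, hsum]

theorem iterExpect_const (hsum : ∑ i, p i = 1) (k : ℕ) (w : List Letter) (r : ℝ) :
    iterExpect p k w (fun _ => r) = r := by
  induction k generalizing w with
  | zero => rfl
  | succ k ih => simp [iterExpect_succ, ih, expect_const hsum]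

theorem expect_pos (hpos : ∀ i, 0 < p i) {w v : List Letter} {f : List Letter → ℝ}
    (hf : ∀ u ∈ images m w, 0 ≤ f u) (hv : v ∈ images m w) (hfv : 0 < f v) : 0 < expect p w f := by
  obtain ⟨c, rfl⟩ := hv
  rw [expect_apply]
  exact Finset.sum_pos' (fun c _ => mul_nonneg (Finset.prod_nonneg fun i _ => (hpos _).le)
    (hf _ ⟨c, rfl⟩)) ⟨c, Finset.mem_univ _, mul_pos (Finset.prod_pos fun i _ => hpos _) hfv⟩

theorem iterExpect_nonneg (hp : ∀ i, 0 ≤ p i) {k : ℕ} {w : List Letter} {f : List Letter → ℝ}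
    (h : ∀ v ∈ iterImages m k w, 0 ≤ f v) : 0 ≤ iterExpect p k w f := by
  simpa using iterExpect_mono hp (f := 0) h

theorem iterExpect_pos (hpos : ∀ i, 0 < p i) {k : ℕ} {w v : List Letter} {f : List Letter → ℝ}
    (hf : ∀ u ∈ iterImages m k w, 0 ≤ f u) (hv : v ∈ iterImages m k w) (hfv : 0 < f v) :
    0 < iterExpect p k w f := by
  induction k generalizing w with
  | zero => obtain rfl : v = w := hv; exact hfv
  | succ k ih =>
    obtain ⟨u, hu, hvu⟩ := (mem_iterImages_succ k w v).1 hv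
    have h (u) (hu : u ∈ images m w) : ∀ v ∈ iterImages m k u, 0 ≤ f v :=
      fun v hv => hf v ((mem_iterImages_succ k w v).2 ⟨u, hu, hv⟩)
    rw [iterExpect_succ]
    exact expect_pos hpos (fun u hu => iterExpect_nonneg (fun i => (hpos i).le) (h u hu)) hu
      (ih (h u hu) hvu)

theorem abs_iterExpect_le (hp : ∀ i, 0 ≤ p i) (hsum : ∑ i, p i = 1) {k : ℕ} {w : List Letter}
    {f : List Letter → ℝ} {B : ℝ} (h : ∀ v ∈ iterImages m k w, |f v| ≤ B) :
    |iterExpect p k w f| ≤ B := by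
  rw [abs_le]
  constructor
  · simpa [iterExpect_const hsum] using
      iterExpect_mono hp (f := fun _ => -B) fun v hv => (abs_le.1 (h v hv)).1
  · simpa [iterExpect_const hsum] using
      iterExpect_mono hp (g := fun _ => B) fun v hv => (abs_le.1 (h v hv)).2

/-! ### Images of words and their lengths -/

/-- The length of every image of a letter under the `k`-th power of the substitution. -/
def inflLen (m : ℕ) : ℕ → Letter → ℕ
  | 0, _ => 1
  | k + 1, Letter.a => m * inflLen m k Letter.a + inflLen m k Letter.b
  | k + 1, Letter.b => inflLen m k Letter.a

/-- The length of every image of a word under the `k`-th power of the substitution. -/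
def wordLen (m k : ℕ) (w : List Letter) : ℕ := (w.map (inflLen m k)).sum

@[simp]
theorem wordLen_nil (k : ℕ) : wordLen m k [] = 0 := rfl

@[simp]
theorem wordLen_cons (k : ℕ) (x : Letter) (w : List Letter) :
    wordLen m k (x :: w) = inflLen m k x + wordLen m k w := by simp [wordLen]

@[simp]
theorem wordLen_append (k : ℕ) (v w : List Letter) :
    wordLen m k (v ++ w) = wordLen m k v + wordLen m k w := by simp [wordLen]

@[simp]
theorem wordLen_zero (w : List Letter) : wordLen m 0 w = w.length := by
  simp [wordLen, inflLen]

theorem inflLen_pos (k : ℕ) (x : Letter) : 1 ≤ inflLen m k x := by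
  induction k generalizing x with
  | zero => simp [inflLen]
  | succ k ih =>
    cases x with
    | a => simp only [inflLen]; have := ih Letter.b; omega
    | b => exact ih Letter.a

theorem length_le_wordLen (k : ℕ) (w : List Letter) : w.length ≤ wordLen m k w := by
  induction w with
  | nil => simp
  | cons x w ih => have := inflLen_pos (m := m) k x; simp; omega

theorem inflLen_le (hm : 1 ≤ m) (k : ℕ) (x : Letter) : inflLen m k x ≤ inflLen m k Letter.a := by
  cases x with
  | a => exact le_rfl
  | b =>
    cases k with
    | zero => exact le_rfl
    | succ k =>
      simp only [inflLen]
      nlinarith [inflLen_pos (m := m) k Letter.b]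

/-- The lengths of the images of the two letters are comparable. -/
theorem inflLen_a_le (hm : 1 ≤ m) (k : ℕ) (x : Letter) :
    inflLen m k Letter.a ≤ (m + 1) * inflLen m k x := by
  have hb : inflLen m k Letter.a ≤ (m + 1) * inflLen m k Letter.b := by
    cases k with
    | zero => simp [inflLen]
    | succ k => simp only [inflLen]; nlinarith [inflLen_le hm k Letter.b]
  exact hb.trans (Nat.mul_le_mul_left _ (by cases x; exacts [inflLen_le hm k _, le_rfl]))

theorem length_letterImage (x : Letter) (i : Fin (m + 1)) :
    (letterImage m x i).length = inflLen m 1 x := by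
  cases x with
  | a => simp [letterImage, inflLen]; omega
  | b => simp [letterImage, inflLen]

theorem wordLen_letterImage (k : ℕ) (x : Letter) (i : Fin (m + 1)) :
    wordLen m k (letterImage m x i) = inflLen m (k + 1) x := by
  cases x with
  | a =>
    obtain ⟨j, hj⟩ : ∃ j, m = i + j := ⟨m - i, by omega⟩
    have : m - (i : ℕ) = j := by omega
    simp only [letterImage, wordLen_append, wordLen_cons, inflLen, this]
    simp only [wordLen, List.map_replicate, List.sum_replicate, smul_eq_mul]
    have : m * inflLen m k Letter.a = (i + j) * inflLen m k Letter.a := by rw [← hj]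
    linarith
  | b => simp [letterImage, inflLen]

theorem mem_images_nil {v : List Letter} : v ∈ images m [] ↔ v = [] := by
  constructor
  · rintro ⟨c, rfl⟩; simp [wordImage]
  · rintro rfl; exact ⟨fun i => i.elim0, by simp [wordImage]⟩

theorem mem_images_cons {x : Letter} {w v : List Letter} :
    v ∈ images m (x :: w) ↔ ∃ i, ∃ u ∈ images m w, v = letterImage m x i ++ u := by
  constructor
  · rintro ⟨c, rfl⟩
    exact ⟨c 0, _, ⟨fun i => c i.succ, rfl⟩, by simp [wordImage, List.ofFn_succ]⟩
  · rintro ⟨i, u, ⟨c, rfl⟩, rfl⟩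
    exact ⟨Fin.cons i c, by simp [wordImage, List.ofFn_succ]⟩

theorem append_mem_images {w₁ w₂ v₁ v₂ : List Letter} (h₁ : v₁ ∈ images m w₁)
    (h₂ : v₂ ∈ images m w₂) : v₁ ++ v₂ ∈ images m (w₁ ++ w₂) := by
  induction w₁ generalizing v₁ with
  | nil => simpa [mem_images_nil.1 h₁] using h₂
  | cons x w ih =>
    obtain ⟨i, u, hu, rfl⟩ := mem_images_cons.1 h₁
    rw [List.cons_append, mem_images_cons]
    exact ⟨i, u ++ v₂, ih hu, by simp⟩

theorem append_mem_iterImages {k : ℕ} {w₁ w₂ v₁ v₂ : List Letter} (h₁ : v₁ ∈ iterImages m k w₁)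
    (h₂ : v₂ ∈ iterImages m k w₂) : v₁ ++ v₂ ∈ iterImages m k (w₁ ++ w₂) := by
  induction k generalizing v₁ v₂ with
  | zero => obtain rfl : v₁ = w₁ := h₁; obtain rfl : v₂ = w₂ := h₂; rfl
  | succ k ih =>
    obtain ⟨u₁, hu₁, hv₁⟩ := h₁
    obtain ⟨u₂, hu₂, hv₂⟩ := h₂
    exact ⟨_, ih hu₁ hu₂, append_mem_images hv₁ hv₂⟩

theorem images_nonempty (w : List Letter) : (images m w).Nonempty := ⟨_, fun _ => 0, rfl⟩

theorem iterImages_nonempty (k : ℕ) (w : List Letter) : (iterImages m k w).Nonempty := by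
  induction k with
  | zero => exact ⟨w, rfl⟩
  | succ k ih =>
    obtain ⟨u, hu⟩ := ih
    obtain ⟨v, hv⟩ := images_nonempty (m := m) u
    exact ⟨v, u, hu, hv⟩

theorem iterImages_trans {j k : ℕ} {u v w : List Letter} (hv : v ∈ iterImages m j w)
    (hu : u ∈ iterImages m k v) : u ∈ iterImages m (j + k) w := by
  induction k generalizing u with
  | zero => obtain rfl : u = v := hu; exact hv
  | succ k ih =>
    obtain ⟨x, hx, hux⟩ := hu
    exact ⟨x, ih hx, hux⟩

theorem wordLen_of_mem_images {k : ℕ} {w v : List Letter} (h : v ∈ images m w) :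
    wordLen m k v = wordLen m (k + 1) w := by
  induction w generalizing v with
  | nil => simp [mem_images_nil.1 h]
  | cons x w ih =>
    obtain ⟨i, u, hu, rfl⟩ := mem_images_cons.1 h
    simp [wordLen_letterImage, ih hu]

theorem length_of_mem_iterImages {k : ℕ} {w v : List Letter} (h : v ∈ iterImages m k w) :
    v.length = wordLen m k w := by
  induction k generalizing w with
  | zero => obtain rfl : v = w := h; simp
  | succ k ih =>
    obtain ⟨u, hu, hv⟩ := (mem_iterImages_succ k w v).1 h
    rw [ih hv, wordLen_of_mem_images hu]

theorem length_of_mem_images {w v : List Letter} (h : v ∈ images m w) :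
    v.length = wordLen m 1 w := by
  simpa using wordLen_of_mem_images (k := 0) h

theorem singleton_b_images {v : List Letter} : v ∈ images m [Letter.b] ↔ v = [Letter.a] := by
  rw [mem_images_cons]
  constructor
  · rintro ⟨i, u, hu, rfl⟩; simp [mem_images_nil.1 hu, letterImage]
  · rintro rfl; exact ⟨0, [], mem_images_nil.2 rfl, by simp [letterImage]⟩

theorem letterImage_mem_images (x : Letter) (i : Fin (m + 1)) :
    letterImage m x i ∈ images m [x] :=
  mem_images_cons.2 ⟨i, [], mem_images_nil.2 rfl, by simp⟩

/-! ### The inflation factor -/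

/-- The inflation factor of the noble means substitution, the positive root of
`x² = m x + 1`. -/
noncomputable def infl (m : ℕ) : ℝ := (m + √((m : ℝ) ^ 2 + 4)) / 2

theorem infl_sq : infl m ^ 2 = m * infl m + 1 := by
  have := Real.sq_sqrt (show (0 : ℝ) ≤ (m : ℝ) ^ 2 + 4 by positivity)
  unfold infl
  linear_combination this / 4

theorem one_lt_infl (hm : 1 ≤ m) : 1 < infl m := by
  have h1 : (1 : ℝ) ≤ m := by exact_mod_cast hm
  have : (1 : ℝ) < √((m : ℝ) ^ 2 + 4) := Real.lt_sqrt_of_sq_lt (by nlinarith)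
  unfold infl
  linarith

/-- The image lengths satisfy the same recursion as the powers of the inflation factor, with larger
initial values. -/
theorem infl_pow_le_inflLen (hm : 1 ≤ m) (k : ℕ) : infl m ^ k ≤ inflLen m k Letter.a := by
  have h1 := one_lt_infl hm
  have hsq := infl_sq (m := m)
  have key : ∀ k, infl m ^ k ≤ inflLen m k Letter.a ∧
      infl m ^ (k + 1) ≤ inflLen m (k + 1) Letter.a := by
    intro k
    induction k with
    | zero =>
      refine ⟨by simp [inflLen], ?_⟩
      have : infl m * (infl m - m) = 1 := by linear_combination hsq
      have : infl m ≤ m + 1 := by nlinarith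
      simpa [inflLen] using this
    | succ k ih =>
      refine ⟨ih.2, ?_⟩
      have h0 : (0 : ℝ) ≤ m := Nat.cast_nonneg m
      have : infl m ^ (k + 1 + 1) = m * infl m ^ (k + 1) + infl m ^ k := by
        linear_combination infl m ^ k * hsq
      rw [this]
      simp only [inflLen] at ih ⊢
      push_cast at ih ⊢
      nlinarith
  exact (key k).1

theorem tendsto_inflLen (hm : 1 ≤ m) :
    Tendsto (fun k => (inflLen m k Letter.a : ℝ)) atTop atTop :=
  tendsto_atTop_mono (infl_pow_le_inflLen hm) (tendsto_pow_atTop_atTop_of_one_lt (one_lt_infl hm))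

/-- A solution of the recursion `c (k + 2) = m * c (k + 1) + c k` up to bounded errors is a
multiple of `infl m ^ k` up to a bounded error: the second root of the characteristic polynomial
has modulus less than `1`. -/
theorem exists_abs_sub_mul_infl_pow_le (hm : 1 ≤ m) {c : ℕ → ℝ} {D : ℝ}
    (hc : ∀ k, |c (k + 2) - m * c (k + 1) - c k| ≤ D) :
    ∃ F C : ℝ, ∀ k, |c k - F * infl m ^ k| ≤ C := by
  have h1 := one_lt_infl hm
  have h0 : 0 < infl m := by linarith
  have hsq := infl_sq (m := m)
  have hD : 0 ≤ D := (abs_nonneg _).trans (hc 0)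
  set l := infl m with hl
  have hl1 : 0 < l - 1 := by linarith
  -- `C` bounds `|c 1 - l * c 0|` and is mapped below itself by `t ↦ t / l + D`
  set C := |c 1 - l * c 0| + D * l / (l - 1) with hC
  have hC0 : 0 ≤ C := by positivity
  have hCD : C / l + D ≤ C := by
    have : D * l / (l - 1) ≤ C := by simp [hC]
    rw [div_le_iff₀ hl1] at this
    rw [div_add' _ _ _ h0.ne', div_le_iff₀ h0]
    linarith
  have he : ∀ k, |c (k + 1) - l * c k| ≤ C := by
    intro k
    induction k with
    | zero =>
      have : 0 ≤ D * l / (l - 1) := by positivity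
      simp only [hC, zero_add]; linarith
    | succ k ih =>
      -- the second root of the characteristic polynomial is `-1 / l`
      have e : c (k + 1 + 1) - l * c (k + 1) =
          -((c (k + 1) - l * c k) / l) + (c (k + 2) - m * c (k + 1) - c k) := by
        field_simp
        linear_combination -c (k + 1) * hsq
      rw [e]
      refine (abs_add_le _ _).trans ?_
      rw [abs_neg, abs_div, abs_of_pos h0]
      have := div_le_div_of_nonneg_right ih h0.le
      linarith [hc k]
  have hr : l⁻¹ < 1 := inv_lt_one_of_one_lt₀ h1
  have hd : ∀ k, dist (c k / l ^ k) (c (k + 1) / l ^ (k + 1)) ≤ C / l * l⁻¹ ^ k := by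
    intro k
    rw [dist_comm, Real.dist_eq]
    have : c (k + 1) / l ^ (k + 1) - c k / l ^ k = (c (k + 1) - l * c k) / l ^ (k + 1) := by
      field_simp
      ring
    rw [this, abs_div, abs_of_pos (pow_pos h0 _)]
    have e2 : C / l * l⁻¹ ^ k = C / l ^ (k + 1) := by
      rw [inv_pow, pow_succ]; field_simp
    rw [e2]
    exact div_le_div_of_nonneg_right (he k) (pow_pos h0 _).le
  obtain ⟨F, hF⟩ := cauchySeq_tendsto_of_complete (cauchySeq_of_le_geometric l⁻¹ (C / l) hr hd)
  refine ⟨F, C / l / (1 - l⁻¹), fun k => ?_⟩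
  have := dist_le_of_le_geometric_of_tendsto l⁻¹ (C / l) hr hd hF k
  rw [Real.dist_eq] at this
  have e : c k - F * l ^ k = (c k / l ^ k - F) * l ^ k := by field_simp
  rw [e, abs_mul, abs_of_pos (pow_pos h0 k)]
  calc _ ≤ C / l * l⁻¹ ^ k / (1 - l⁻¹) * l ^ k := by gcongr
    _ = C / l / (1 - l⁻¹) := by
      rw [inv_pow]
      have := (pow_pos h0 k).ne'
      rw [div_mul_eq_mul_div, mul_assoc, inv_mul_cancel₀ this, mul_one]

/-- Each step of the substitution multiplies the lengths of the images by the inflation factor, up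
to a bounded error. -/
theorem exists_abs_inflLen_succ_sub_le (hm : 1 ≤ m) : ∃ C : ℝ, ∀ k x,
    |(inflLen m (k + 1) x : ℝ) - infl m * inflLen m k x| ≤ C := by
  have h1 := one_lt_infl hm
  have hsq := infl_sq (m := m)
  have key : ∀ k, |(inflLen m (k + 1) Letter.a : ℝ) - infl m * inflLen m k Letter.a| ≤
      |(m : ℝ) + 1 - infl m| := by
    intro k
    induction k with
    | zero => simp [inflLen]
    | succ k ih =>
      refine le_trans ?_ ih
      have e : (inflLen m (k + 1 + 1) Letter.a : ℝ) - infl m * inflLen m (k + 1) Letter.a =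
          -((inflLen m (k + 1) Letter.a - infl m * inflLen m k Letter.a) / infl m) := by
        have : (inflLen m (k + 1 + 1) Letter.a : ℝ) =
            m * inflLen m (k + 1) Letter.a + inflLen m k Letter.a := by
          rw [inflLen]; push_cast; rfl
        rw [this]
        field_simp
        linear_combination -(inflLen m (k + 1) Letter.a : ℝ) * hsq
      rw [e, abs_neg, abs_div, abs_of_pos (by linarith : 0 < infl m)]
      exact div_le_self (abs_nonneg _) h1.le
  refine ⟨|(m : ℝ) + 1 - infl m| + |1 - infl m|, fun k x => ?_⟩
  cases x with
  | a => linarith [key k, abs_nonneg (1 - infl m)]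
  | b =>
    cases k with
    | zero => simp [inflLen]
    | succ k =>
      have := key k
      simp only [inflLen] at this ⊢
      linarith [abs_nonneg (1 - infl m)]

/-! ### Legal words -/

theorem Legal.mono {u v : List Letter} (hv : Legal m v) (h : u <:+: v) : Legal m u := by
  obtain ⟨k, hk, w, hw, hvw⟩ := hv
  exact ⟨k, hk, w, hw, h.trans hvw⟩

theorem a_mem_iterImages : [Letter.a] ∈ iterImages m 1 [Letter.b] :=
  ⟨[Letter.b], rfl, singleton_b_images.2 rfl⟩

/-- Images of `a` are legal because `a` is the image of `b`; the word `b` itself occurs in an image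
of `a`. -/
theorem legal_of_mem_iterImages {k : ℕ} {x : Letter} {v : List Letter}
    (h : v ∈ iterImages m k [x]) : Legal m v := by
  cases x with
  | a => exact ⟨1 + k, by omega, v, iterImages_trans a_mem_iterImages h, List.infix_refl _⟩
  | b =>
    cases k with
    | succ k => exact ⟨k + 1, by omega, v, h, List.infix_refl _⟩
    | zero =>
      obtain rfl : v = [Letter.b] := h
      refine ⟨2, by omega, letterImage m Letter.a 0,
        ⟨_, a_mem_iterImages, letterImage_mem_images _ _⟩, ?_⟩
      exact ⟨[], List.replicate m Letter.a, by simp [letterImage]⟩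

theorem Legal.of_mem_images {w v : List Letter} (hw : Legal m w) (hv : v ∈ images m w) :
    Legal m v := by
  obtain ⟨k, hk, u, hu, s, t, hst⟩ := hw
  obtain ⟨s', hs'⟩ := images_nonempty (m := m) s
  obtain ⟨t', ht'⟩ := images_nonempty (m := m) t
  refine ⟨k + 1, by omega, s' ++ v ++ t', ⟨u, hu, ?_⟩, s', t', rfl⟩
  rw [← hst]
  exact append_mem_images (append_mem_images hs' hv) ht'

/-! ### Sums of local functions over the suffixes of a word -/

/-- A function of words is local if it is bounded by `B` and depends, for words of length at
least `n`, only on the first `n` letters. -/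
structure IsLocal (n : ℕ) (B : ℝ) (g : List Letter → ℝ) : Prop where
  eq_take : ∀ z, n ≤ z.length → g z = g (z.take n)
  bound : ∀ z, |g z| ≤ B

/-- The sum of `g` over all nonempty suffixes of a word. If `g` indicates the words that start
with `u`, this is the number of occurrences of `u`. -/
noncomputable def occ (g : List Letter → ℝ) (z : List Letter) : ℝ :=
  ∑ i ∈ Finset.range z.length, g (z.drop i)

/-- A sum in which only the last `n` terms can be nonzero. -/
theorem abs_sum_range_le {f : ℕ → ℝ} {L n : ℕ} {c : ℝ} (hc : 0 ≤ c)
    (h0 : ∀ i < L, i + n ≤ L → f i = 0) (hb : ∀ i < L, |f i| ≤ c) :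
    |∑ i ∈ Finset.range L, f i| ≤ n * c := by
  have hs : Finset.Ico (L - n) L ⊆ Finset.range L := by
    intro i; simp
  rw [← Finset.sum_subset hs]
  · refine (Finset.abs_sum_le_sum_abs _ _).trans ?_
    refine (Finset.sum_le_card_nsmul _ _ c fun i hi => hb i (Finset.mem_Ico.1 hi).2).trans ?_
    rw [nsmul_eq_mul, Nat.card_Ico]
    gcongr
    omega
  · intro i hi hi'
    simp only [Finset.mem_range, Finset.mem_Ico, not_and, not_lt] at hi hi'
    exact h0 i hi (by by_contra h; have := hi' (by omega); omega)

theorem IsLocal.nonneg {n : ℕ} {B : ℝ} {g : List Letter → ℝ} (hg : IsLocal n B g) : 0 ≤ B :=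
  (abs_nonneg _).trans (hg.bound [])

theorem IsLocal.mono {n n' : ℕ} {B : ℝ} {g : List Letter → ℝ} (hg : IsLocal n B g)
    (hn : n ≤ n') : IsLocal n' B g where
  eq_take z hz := by
    rw [hg.eq_take z (hn.trans hz), hg.eq_take (z.take n') (by simp; omega), List.take_take,
      min_eq_left hn]
  bound := hg.bound

theorem drop_length_add_append (y z : List Letter) (i : ℕ) :
    (y ++ z).drop (y.length + i) = z.drop i := by
  simp [List.drop_append, List.drop_eq_nil_of_le (show y.length ≤ y.length + i by omega)]

/-- Sums over suffixes are additive under concatenation, up to the words that overlap the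
boundary. -/
theorem abs_occ_append_sub_le {n : ℕ} {B : ℝ} {g : List Letter → ℝ} (hg : IsLocal n B g)
    (y z : List Letter) : |occ g (y ++ z) - occ g y - occ g z| ≤ n * (2 * B) := by
  have hB := hg.nonneg
  have e : occ g (y ++ z) - occ g y - occ g z =
      ∑ i ∈ Finset.range y.length, (g (y.drop i ++ z) - g (y.drop i)) := by
    simp only [occ, List.length_append, Finset.sum_range_add, Finset.sum_sub_distrib]
    have h1 : ∑ i ∈ Finset.range y.length, g ((y ++ z).drop i) =
        ∑ i ∈ Finset.range y.length, g (y.drop i ++ z) :=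
      Finset.sum_congr rfl fun i hi => by
        rw [List.drop_append_of_le_length (Finset.mem_range.1 hi).le]
    have h2 : ∑ i ∈ Finset.range z.length, g ((y ++ z).drop (y.length + i)) =
        ∑ i ∈ Finset.range z.length, g (z.drop i) :=
      Finset.sum_congr rfl fun i hi => by
        rw [drop_length_add_append]
    rw [h1, h2]
    ring
  rw [e]
  refine abs_sum_range_le (by positivity) (fun i hi hin => ?_) fun i hi => ?_
  · have hl : n ≤ (y.drop i).length := by simp; omega
    rw [hg.eq_take _ hl, hg.eq_take (y.drop i ++ z) (by simp at hl ⊢; omega),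
      List.take_append_of_le_length hl, sub_self]
  · linarith [abs_sub (g (y.drop i ++ z)) (g (y.drop i)), hg.bound (y.drop i ++ z),
      hg.bound (y.drop i)]

/-- Two local functions that agree on long words have almost the same sums over suffixes. -/
theorem abs_occ_sub_le {n : ℕ} {B : ℝ} {g g' : List Letter → ℝ} {z : List Letter} (hB : 0 ≤ B)
    (hg : ∀ z, |g z| ≤ B) (hg' : ∀ z, |g' z| ≤ B)
    (h : ∀ i, i + n ≤ z.length → g (z.drop i) = g' (z.drop i)) :
    |occ g z - occ g' z| ≤ n * (2 * B) := by
  rw [occ, occ, ← Finset.sum_sub_distrib]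
  refine abs_sum_range_le (by positivity) (fun i hi hin => ?_) fun i hi => ?_
  · rw [h i hin, sub_self]
  · linarith [abs_sub (g (z.drop i)) (g' (z.drop i)), hg (z.drop i), hg' (z.drop i)]

/-! ### Frequencies -/

/-- The local function `g` has frequency `ρ` if its expected sum over the suffixes of an image of a
letter is `ρ` times the length of that image, up to an error that is bounded uniformly in the
power of the substitution. -/
def HasFreq (p : Fin (m + 1) → ℝ) (g : List Letter → ℝ) (ρ : ℝ) : Prop :=
  ∃ C : ℝ, ∀ k x, |iterExpect p k [x] (occ g) - ρ * inflLen m k x| ≤ C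

theorem iterExpect_sub_const (hsum : ∑ i, p i = 1) (k : ℕ) (w : List Letter)
    (f : List Letter → ℝ) (r : ℝ) :
    iterExpect p k w (fun z => f z - r) = iterExpect p k w f - r := by
  have := map_sub (iterExpect p k w) f fun _ => r
  rwa [iterExpect_const hsum] at this

theorem HasFreq.of_abs_le (hp : ∀ i, 0 ≤ p i) (hsum : ∑ i, p i = 1) {g g' : List Letter → ℝ}
    {ρ C : ℝ} (h : HasFreq p g ρ) (hC : ∀ z, Legal m z → |occ g' z - occ g z| ≤ C) :
    HasFreq p g' ρ := by
  obtain ⟨C', hC'⟩ := h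
  refine ⟨C + C', fun k x => ?_⟩
  have h1 : |iterExpect p k [x] (occ g') - iterExpect p k [x] (occ g)| ≤ C := by
    rw [← map_sub]
    exact abs_iterExpect_le hp hsum fun v hv => hC v (legal_of_mem_iterImages hv)
  have h2 := abs_add_le (iterExpect p k [x] (occ g') - iterExpect p k [x] (occ g))
    (iterExpect p k [x] (occ g) - ρ * inflLen m k x)
  rw [sub_add_sub_cancel] at h2
  linarith [hC' k x]

/-- The frequency depends only on the values at long legal words. -/
theorem HasFreq.congr (hp : ∀ i, 0 ≤ p i) (hsum : ∑ i, p i = 1) {g g' : List Letter → ℝ}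
    {ρ B : ℝ} (n : ℕ) (h : HasFreq p g ρ) (hB : ∀ z, |g z| ≤ B) (hB' : ∀ z, |g' z| ≤ B)
    (hg : ∀ z, Legal m z → n ≤ z.length → g z = g' z) : HasFreq p g' ρ :=
  h.of_abs_le hp hsum fun z hz => abs_occ_sub_le (n := n) ((abs_nonneg _).trans (hB [])) hB' hB
    fun i hi => (hg _ (hz.mono (List.drop_suffix i z).isInfix) (by simp; omega)).symm

theorem HasFreq.unique (hm : 1 ≤ m) {g : List Letter → ℝ} {ρ ρ' : ℝ} (h : HasFreq p g ρ)
    (h' : HasFreq p g ρ') : ρ = ρ' := by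
  obtain ⟨C, hC⟩ := h
  obtain ⟨C', hC'⟩ := h'
  by_contra hne
  have hpos : 0 < |ρ - ρ'| := abs_pos.2 (sub_ne_zero.2 hne)
  obtain ⟨k, hk⟩ := ((tendsto_inflLen hm).eventually_gt_atTop ((C + C') / |ρ - ρ'|)).exists
  rw [div_lt_iff₀ hpos] at hk
  have e : |(ρ - ρ') * inflLen m k Letter.a| ≤ C + C' := by
    have := abs_sub (iterExpect p k [Letter.a] (occ g) - ρ' * inflLen m k Letter.a)
      (iterExpect p k [Letter.a] (occ g) - ρ * inflLen m k Letter.a)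
    rw [sub_sub_sub_cancel_left, ← sub_mul] at this
    linarith [hC k Letter.a, hC' k Letter.a]
  rw [abs_mul, Nat.abs_cast] at e
  linarith

theorem occ_const_mul (r : ℝ) (g : List Letter → ℝ) : occ (fun z => r * g z) = r • occ g := by
  funext z
  simp [occ, Finset.mul_sum]

theorem HasFreq.const_mul {g : List Letter → ℝ} {ρ : ℝ} (h : HasFreq p g ρ) (r : ℝ) :
    HasFreq p (fun z => r * g z) (r * ρ) := by
  obtain ⟨C, hC⟩ := h
  refine ⟨|r| * C, fun k x => ?_⟩
  rw [occ_const_mul, map_smul, smul_eq_mul, mul_assoc, ← mul_sub, abs_mul]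
  exact mul_le_mul_of_nonneg_left (hC k x) (abs_nonneg r)

theorem HasFreq.sum {ι : Type*} (s : Finset ι) {g : ι → List Letter → ℝ} {ρ : ι → ℝ}
    (h : ∀ i, HasFreq p (g i) (ρ i)) : HasFreq p (fun z => ∑ i ∈ s, g i z) (∑ i ∈ s, ρ i) := by
  choose C hC using h
  refine ⟨∑ i ∈ s, C i, fun k x => ?_⟩
  have : occ (fun z => ∑ i ∈ s, g i z) = ∑ i ∈ s, occ (g i) := by
    funext z
    simp only [occ, Finset.sum_apply]
    exact Finset.sum_comm
  rw [this, map_sum, Finset.sum_mul, ← Finset.sum_sub_distrib]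
  exact (Finset.abs_sum_le_sum_abs _ _).trans (Finset.sum_le_sum fun i _ => hC i k x)

theorem HasFreq.one (hp : ∀ i, 0 ≤ p i) (hsum : ∑ i, p i = 1) : HasFreq p (fun _ => 1) 1 := by
  refine ⟨0, fun k x => ?_⟩
  rw [iterExpect_congr hp (g := fun _ => (inflLen m k x : ℝ)) fun v hv => by
    simp [occ, length_of_mem_iterImages hv], iterExpect_const hsum]
  simp

theorem HasFreq.nonneg (hm : 1 ≤ m) (hp : ∀ i, 0 ≤ p i) {g : List Letter → ℝ} {ρ : ℝ}
    (h : HasFreq p g ρ) (hg : ∀ z, 0 ≤ g z) : 0 ≤ ρ := by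
  obtain ⟨C, hC⟩ := h
  by_contra! hneg
  obtain ⟨k, hk⟩ := ((tendsto_inflLen hm).eventually_gt_atTop (C / -ρ)).exists
  rw [div_lt_iff₀ (by linarith)] at hk
  have h1 : 0 ≤ iterExpect p k [Letter.a] (occ g) :=
    iterExpect_nonneg hp fun v _ => Finset.sum_nonneg fun i _ => hg _
  linarith [(abs_le.1 (hC k Letter.a)).2]

theorem abs_iterExpect_occ_sub_le (hp : ∀ i, 0 ≤ p i) (hsum : ∑ i, p i = 1) {n : ℕ} {B : ℝ}
    {g : List Letter → ℝ} (hg : IsLocal n B g) (k : ℕ) (x : Letter) (w : List Letter) :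
    |iterExpect p k (x :: w) (occ g) - iterExpect p k [x] (occ g) - iterExpect p k w (occ g)| ≤
      n * (2 * B) := by
  have h1 : iterExpect p k [x] (occ g) =
      iterExpect p k [x] fun y => iterExpect p k w fun _ => occ g y := by
    simp [iterExpect_const hsum]
  have h2 : iterExpect p k w (occ g) = iterExpect p k [x] fun _ => iterExpect p k w (occ g) := by
    simp [iterExpect_const hsum]
  rw [← List.singleton_append, iterExpect_append, h1, h2, ← map_sub, ← map_sub]
  refine abs_iterExpect_le hp hsum fun y _ => ?_
  simp only [Pi.sub_apply]
  rw [← map_sub, ← map_sub]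
  exact abs_iterExpect_le hp hsum fun z _ => abs_occ_append_sub_le hg y z

theorem abs_iterExpect_occ_sub_sum_le (hp : ∀ i, 0 ≤ p i) (hsum : ∑ i, p i = 1) {n : ℕ} {B : ℝ}
    {g : List Letter → ℝ} (hg : IsLocal n B g) (k : ℕ) (w : List Letter) :
    |iterExpect p k w (occ g) - (w.map fun x => iterExpect p k [x] (occ g)).sum| ≤
      w.length * (n * (2 * B)) := by
  induction w with
  | nil =>
    have h0 : iterExpect p k [] (occ g) = 0 := by
      rw [iterExpect_congr hp (g := fun _ => (0 : ℝ)) fun v hv => ?_, iterExpect_const hsum]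
      have := length_of_mem_iterImages hv
      simp only [wordLen_nil, List.length_eq_zero_iff] at this
      simp [this, occ]
    simp [h0]
  | cons x w ih =>
    have h1 := abs_iterExpect_occ_sub_le hp hsum hg k x w
    simp only [List.map_cons, List.sum_cons, List.length_cons]
    push_cast
    rw [abs_le] at *
    constructor <;> linarith [h1.1, h1.2, ih.1, ih.2]

/-- Every local function has a frequency: by quasi-additivity, the expected sums over the images
of `a` satisfy the recursion of the inflation factor up to a bounded error. -/
theorem IsLocal.exists_hasFreq (hm : 1 ≤ m) (hp : ∀ i, 0 ≤ p i) (hsum : ∑ i, p i = 1) {n : ℕ}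
    {B : ℝ} {g : List Letter → ℝ} (hg : IsLocal n B g) : ∃ ρ, HasFreq p g ρ := by
  have hb (k : ℕ) :
      iterExpect p (k + 1) [Letter.b] (occ g) = iterExpect p k [Letter.a] (occ g) := by
    rw [iterExpect_succ, expect_cons]
    simp [letterImage, expect_nil, ← Finset.sum_mul, hsum]
  have hrec (k : ℕ) : |iterExpect p (k + 2) [Letter.a] (occ g) -
      m * iterExpect p (k + 1) [Letter.a] (occ g) - iterExpect p k [Letter.a] (occ g)| ≤
      (m + 1) * (n * (2 * B)) := by
    have e : iterExpect p (k + 2) [Letter.a] (occ g) -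
        m * iterExpect p (k + 1) [Letter.a] (occ g) - iterExpect p k [Letter.a] (occ g) =
        iterExpect p 1 [Letter.a] fun z => iterExpect p (k + 1) z (occ g) -
          (m * iterExpect p (k + 1) [Letter.a] (occ g) + iterExpect p k [Letter.a] (occ g)) := by
      rw [iterExpect_sub_const hsum, iterExpect_succ p 0, iterExpect_succ]
      simp only [iterExpect_zero]
      ring
    rw [e]
    refine abs_iterExpect_le hp hsum fun z hz => ?_
    obtain ⟨y, hy, hz⟩ := hz
    obtain rfl : y = [Letter.a] := hy
    obtain ⟨i, u, hu, rfl⟩ := mem_images_cons.1 hz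
    obtain rfl := mem_images_nil.1 hu
    have h1 := abs_iterExpect_occ_sub_sum_le hp hsum hg (k + 1) (letterImage m Letter.a i ++ [])
    have h2 : ((letterImage m Letter.a i ++ []).map
        fun x => iterExpect p (k + 1) [x] (occ g)).sum =
        m * iterExpect p (k + 1) [Letter.a] (occ g) + iterExpect p k [Letter.a] (occ g) := by
      have : ((m - (i : ℕ) : ℕ) : ℝ) = m - i := Nat.cast_sub (by omega)
      simp [letterImage, hb, this]
      ring
    rw [h2, List.append_nil] at h1
    simpa [length_letterImage, inflLen] using h1
  obtain ⟨F, C, hFC⟩ := exists_abs_sub_mul_infl_pow_le hm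
    (c := fun k => iterExpect p k [Letter.a] (occ g)) hrec
  -- the lengths of the images satisfy the same recursion without an error
  obtain ⟨L, C', hLC⟩ := exists_abs_sub_mul_infl_pow_le hm (D := 0)
    (c := fun k => (inflLen m k Letter.a : ℝ)) fun k => by simp [inflLen]
  have hL : L ≠ 0 := by
    rintro rfl
    obtain ⟨k, hk⟩ := ((tendsto_inflLen hm).eventually_gt_atTop C').exists
    have := hLC k
    simp only [zero_mul, sub_zero] at this
    linarith [le_abs_self (inflLen m k Letter.a : ℝ)]
  have ha (k : ℕ) : |iterExpect p k [Letter.a] (occ g) - F / L * inflLen m k Letter.a| ≤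
      C + |F / L| * C' := by
    have e : iterExpect p k [Letter.a] (occ g) - F / L * inflLen m k Letter.a =
        (iterExpect p k [Letter.a] (occ g) - F * infl m ^ k) -
          F / L * (inflLen m k Letter.a - L * infl m ^ k) := by
      field_simp
      ring
    rw [e]
    refine (abs_sub _ _).trans (add_le_add (hFC k) ?_)
    rw [abs_mul]
    exact mul_le_mul_of_nonneg_left (hLC k) (abs_nonneg _)
  refine ⟨F / L, (C + |F / L| * C') + |iterExpect p 0 [Letter.b] (occ g) - F / L|, fun k x => ?_⟩
  cases x with
  | a => linarith [ha k, abs_nonneg (iterExpect p 0 [Letter.b] (occ g) - F / L)]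
  | b =>
    cases k with
    | zero =>
      simp only [inflLen, Nat.cast_one, mul_one]
      linarith [(abs_nonneg _).trans (ha 0)]
    | succ k =>
      rw [hb, inflLen]
      linarith [ha k, abs_nonneg (iterExpect p 0 [Letter.b] (occ g) - F / L)]

/-! ### The induced substitution on local functions -/

theorem wordLen_take_one_le (hm : 1 ≤ m) (k : ℕ) (y : List Letter) :
    wordLen m k (y.take 1) ≤ inflLen m k Letter.a := by
  cases y with
  | nil => simp
  | cons x t => simpa using inflLen_le hm k x

/-- The expected sum of `g` over those suffixes of a random image of `y` under the `k`-th power that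
start in the image of the first letter of `y`. For `k = 1` this is the action of the transpose of
the substitution matrix of the induced substitution. -/
noncomputable def induced (p : Fin (m + 1) → ℝ) (k : ℕ) (g : List Letter → ℝ) (y : List Letter) :
    ℝ :=
  iterExpect p k y fun z => ∑ i ∈ Finset.range (wordLen m k (y.take 1)), g (z.drop i)

/-- Sums over the suffixes of an image split according to the letter in whose image the suffix
starts. -/
theorem iterExpect_sum_range_eq (hp : ∀ i, 0 ≤ p i) (hsum : ∑ i, p i = 1) (k : ℕ)
    (g : List Letter → ℝ) (r : ℕ) (y : List Letter) (hr : r ≤ y.length) :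
    iterExpect p k y (fun z => ∑ i ∈ Finset.range (wordLen m k (y.take r)), g (z.drop i)) =
      ∑ j ∈ Finset.range r, induced p k g (y.drop j) := by
  induction r generalizing y with
  | zero => simp [iterExpect_const hsum]
  | succ r ih =>
    cases y with
    | nil => simp at hr
    | cons x t =>
      have h1 : iterExpect p k (x :: t) (fun z => ∑ i ∈ Finset.range (wordLen m k (t.take r)),
          g (z.drop (inflLen m k x + i))) = ∑ j ∈ Finset.range r, induced p k g (t.drop j) := by
        rw [← ih t (by simpa using hr), ← List.singleton_append, iterExpect_append,
          iterExpect_congr hp (g := fun _ => iterExpect p k t fun z =>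
            ∑ i ∈ Finset.range (wordLen m k (t.take r)), g (z.drop i)), iterExpect_const hsum]
        intro v hv
        have hl : v.length = inflLen m k x := by simpa using length_of_mem_iterImages hv
        simp only [← hl, drop_length_add_append]
      rw [Finset.sum_range_succ']
      simp only [List.take_succ_cons, wordLen_cons, Finset.sum_range_add, List.drop_succ_cons,
        List.drop_zero]
      rw [← h1, induced]
      simp only [List.take_succ_cons, List.take_zero, wordLen_cons, wordLen_nil, add_zero]
      exact (map_add (iterExpect p k (x :: t)) _ _).trans (add_comm _ _)

theorem iterExpect_occ_eq (hp : ∀ i, 0 ≤ p i) (hsum : ∑ i, p i = 1) (k : ℕ)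
    (g : List Letter → ℝ) (y : List Letter) :
    iterExpect p k y (occ g) = occ (induced p k g) y := by
  rw [occ, ← iterExpect_sum_range_eq hp hsum k g _ y le_rfl, List.take_length]
  exact iterExpect_congr hp fun v hv => by rw [occ, length_of_mem_iterImages hv]

theorem iterExpect_one (w : List Letter) (f : List Letter → ℝ) :
    iterExpect p 1 w f = expect p w f := by simp [iterExpect_succ]

/-- The induced substitution of a power is the power of the induced substitution. -/
theorem induced_succ (hp : ∀ i, 0 ≤ p i) (hsum : ∑ i, p i = 1) (k : ℕ)
    (g : List Letter → ℝ) (y : List Letter) :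
    induced p (k + 1) g y = induced p 1 (induced p k g) y := by
  rw [induced, induced, iterExpect_succ, iterExpect_one]
  refine expect_congr hp fun w hw => ?_
  have hlen : wordLen m (k + 1) (y.take 1) = wordLen m k (w.take (wordLen m 1 (y.take 1))) := by
    cases y with
    | nil => simp
    | cons x t =>
      obtain ⟨i, u, hu, rfl⟩ := mem_images_cons.1 hw
      simp [← length_letterImage x i, wordLen_letterImage]
  rw [hlen]
  refine iterExpect_sum_range_eq hp hsum k g _ w ?_
  rw [length_of_mem_images hw]
  conv_rhs => rw [← List.take_append_drop 1 y, wordLen_append]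
  exact Nat.le_add_right _ _

theorem IsLocal.induced (hm : 1 ≤ m) (hp : ∀ i, 0 ≤ p i) (hsum : ∑ i, p i = 1) {n : ℕ}
    (hn : 1 ≤ n) {B : ℝ} {g : List Letter → ℝ} (hg : IsLocal n B g) (k : ℕ) :
    IsLocal n (inflLen m k Letter.a * B) (induced p k g) where
  eq_take z hz := by
    rw [RNMS.induced, RNMS.induced]
    conv_lhs => rw [← List.take_append_drop n z, iterExpect_append, List.take_append_drop]
    refine iterExpect_congr hp fun v hv => ?_
    rw [iterExpect_congr hp (g := fun _ => ∑ i ∈ Finset.range (wordLen m k ((z.take n).take 1)),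
      g (v.drop i)), iterExpect_const hsum]
    intro v' _
    -- the last suffix that counts still has `n` letters in the image of the first `n` letters
    have hA : wordLen m k (z.take 1) + n ≤ v.length + 1 := by
      rw [length_of_mem_iterImages hv]
      have e := List.take_append_drop 1 (z.take n)
      rw [← e, wordLen_append, List.take_take, min_eq_left hn]
      have := length_le_wordLen (m := m) k ((z.take n).drop 1)
      simp only [List.length_drop, List.length_take] at this
      omega
    rw [List.take_take, min_eq_left hn]
    refine Finset.sum_congr rfl fun i hi => ?_
    have hi' := Finset.mem_range.1 hi
    rw [List.drop_append_of_le_length (by omega), hg.eq_take (v.drop i ++ v') (by simp; omega),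
      hg.eq_take (v.drop i) (by simp; omega), List.take_append_of_le_length (by simp; omega)]
  bound y := by
    refine abs_iterExpect_le hp hsum fun v _ => ?_
    refine (Finset.abs_sum_le_sum_abs _ _).trans ?_
    refine (Finset.sum_le_card_nsmul _ _ B fun i _ => hg.bound _).trans ?_
    rw [Finset.card_range, nsmul_eq_mul]
    have := hg.nonneg
    gcongr
    exact wordLen_take_one_le hm k y

/-- Passing to the induced substitution multiplies frequencies by the inflation factor. -/
theorem HasFreq.induced (hm : 1 ≤ m) (hp : ∀ i, 0 ≤ p i) (hsum : ∑ i, p i = 1)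
    {g : List Letter → ℝ} {ρ : ℝ} (h : HasFreq p g ρ) :
    HasFreq p (induced p 1 g) (infl m * ρ) := by
  obtain ⟨C, hC⟩ := h
  obtain ⟨C', hC'⟩ := exists_abs_inflLen_succ_sub_le hm
  refine ⟨C + |ρ| * C', fun k x => ?_⟩
  have e : iterExpect p k [x] (occ (RNMS.induced p 1 g)) = iterExpect p (k + 1) [x] (occ g) := by
    rw [iterExpect_succ']
    congr 1
    funext z
    rw [← iterExpect_occ_eq hp hsum, iterExpect_one]
  rw [e]
  have h1 := hC (k + 1) x
  have h2 := mul_le_mul_of_nonneg_left (hC' k x) (abs_nonneg ρ)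
  rw [← abs_mul] at h2
  have h3 := abs_add_le (iterExpect p (k + 1) [x] (occ g) - ρ * inflLen m (k + 1) x)
    (ρ * (inflLen m (k + 1) x - infl m * inflLen m k x))
  rw [show iterExpect p (k + 1) [x] (occ g) - ρ * inflLen m (k + 1) x +
    ρ * (inflLen m (k + 1) x - infl m * inflLen m k x) =
    iterExpect p (k + 1) [x] (occ g) - infl m * ρ * inflLen m k x by ring] at h3
  linarith

/-- A shift by one letter does not change frequencies. -/
theorem HasFreq.drop_one (hp : ∀ i, 0 ≤ p i) (hsum : ∑ i, p i = 1) {n : ℕ} {B : ℝ}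
    {g : List Letter → ℝ} (hg : IsLocal n B g) {ρ : ℝ} (h : HasFreq p g ρ) :
    HasFreq p (fun z => g (z.drop 1)) ρ := by
  refine h.of_abs_le hp hsum (C := 2 * B) fun z _ => ?_
  have e : occ (fun z => g (z.drop 1)) z - occ g z = g [] - g z := by
    have h1 := Finset.sum_range_succ (fun i => g (z.drop i)) z.length
    rw [Finset.sum_range_succ'] at h1
    simp only [occ, List.drop_drop]
    simp only [List.drop_length, List.drop_zero] at h1
    linarith
  rw [e]
  linarith [abs_sub (g []) (g z), hg.bound [], hg.bound z]

theorem IsLocal.drop_one {n : ℕ} {B : ℝ} {g : List Letter → ℝ} (hg : IsLocal n B g) :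
    IsLocal (n + 1) B fun z => g (z.drop 1) where
  eq_take z hz := by
    rw [hg.eq_take (z.drop 1) (by simp; omega), hg.eq_take ((z.take (n + 1)).drop 1)
      (by simp; omega), List.drop_take, List.take_take]
    simp
  bound z := hg.bound _

theorem HasFreq.drop (hp : ∀ i, 0 ≤ p i) (hsum : ∑ i, p i = 1) {n : ℕ} {B : ℝ}
    {g : List Letter → ℝ} (hg : IsLocal n B g) {ρ : ℝ} (h : HasFreq p g ρ) (j : ℕ) :
    HasFreq p (fun z => g (z.drop j)) ρ ∧ IsLocal (n + j) B fun z => g (z.drop j) := by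
  induction j with
  | zero => exact ⟨by simpa using h, by simpa using hg⟩
  | succ j ih =>
    have h1 := ih.1.drop_one hp hsum ih.2
    have h2 := ih.2.drop_one
    simp only [List.drop_drop, add_comm 1 j] at h1 h2
    exact ⟨h1, h2⟩

/-! ### The substitution matrix of the induced substitution -/

/-- The indicator function of the words that start with `u`. -/
noncomputable def startsWith {n : ℕ} (u : Fin n → Letter) (z : List Letter) : ℝ :=
  if z.take n = List.ofFn u then 1 else 0

theorem startsWith_nonneg {n : ℕ} (u : Fin n → Letter) (z : List Letter) :
    0 ≤ startsWith u z := by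
  unfold startsWith; split_ifs <;> norm_num

theorem isLocal_startsWith {n : ℕ} (u : Fin n → Letter) : IsLocal n 1 (startsWith u) where
  eq_take z _ := by simp [startsWith, List.take_take]
  bound z := by unfold startsWith; split_ifs <;> norm_num

theorem exists_legalWord {n : ℕ} {z : List Letter} (hz : Legal m z) (hn : n ≤ z.length) :
    ∃ u : LegalWord m n, z.take n = List.ofFn u.1 := by
  have hl : (z.take n).length = n := by simp [hn]
  have e : z.take n = List.ofFn fun i : Fin n => (z.take n).get (Fin.cast hl.symm i) := by
    apply List.ext_get
    · simp [hn]
    · intro i h1 h2; simp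
  exact ⟨⟨_, e ▸ hz.mono (List.take_prefix n z).isInfix⟩, e⟩

theorem sum_mul_startsWith {n : ℕ} {z : List Letter} (hz : Legal m z) (hn : n ≤ z.length)
    (f : List Letter → ℝ) :
    ∑ u : LegalWord m n, f (List.ofFn u.1) * startsWith u.1 z = f (z.take n) := by
  obtain ⟨u, hu⟩ := exists_legalWord hz hn
  rw [Fintype.sum_eq_single u, hu, startsWith, if_pos hu, mul_one]
  intro v hv
  rw [startsWith, if_neg, mul_zero]
  rw [hu, List.ofFn_inj]
  exact fun h => hv (Subtype.ext h.symm)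

theorem induced_startsWith {n : ℕ} [NeZero n] (u w : LegalWord m n) :
    induced p 1 (startsWith u.1) (List.ofFn w.1) = inducedMatrix p n u w := by
  rw [induced, iterExpect_one, expect_ofFn, inducedMatrix]
  refine Finset.sum_congr rfl fun c _ => ?_
  have hl : wordLen m 1 ((List.ofFn w.1).take 1) = (letterImage m (w.1 0) (c 0)).length := by
    rw [length_letterImage]
    obtain ⟨k, rfl⟩ := Nat.exists_eq_succ_of_ne_zero (NeZero.ne n)
    simp [List.ofFn_succ]
  rw [hl]
  simp [startsWith]

theorem induced_eq_sum (hp : ∀ i, 0 ≤ p i) {n : ℕ} [NeZero n] {f : List Letter → ℝ}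
    (hf : ∀ z, n ≤ z.length → f z = f (z.take n)) (w : LegalWord m n) :
    induced p 1 f (List.ofFn w.1) = ∑ u, f (List.ofFn u.1) * inducedMatrix p n u w := by
  simp only [← induced_startsWith]
  simp only [induced]
  have : ∀ u : LegalWord m n, f (List.ofFn u.1) * iterExpect p 1 (List.ofFn w.1) (fun z =>
      ∑ i ∈ Finset.range (wordLen m 1 ((List.ofFn w.1).take 1)), startsWith u.1 (z.drop i)) =
      iterExpect p 1 (List.ofFn w.1) (f (List.ofFn u.1) • fun z =>
      ∑ i ∈ Finset.range (wordLen m 1 ((List.ofFn w.1).take 1)), startsWith u.1 (z.drop i)) :=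
    fun u => by rw [map_smul, smul_eq_mul]
  simp only [this]
  rw [← map_sum]
  refine iterExpect_congr hp fun v hv => ?_
  simp only [Finset.sum_apply, Pi.smul_apply, smul_eq_mul, Finset.mul_sum]
  rw [Finset.sum_comm]
  refine Finset.sum_congr rfl fun i hi => ?_
  have hlen : i + n ≤ v.length := by
    rw [length_of_mem_iterImages hv]
    have h1 := Finset.mem_range.1 hi
    have h2 := length_le_wordLen (m := m) 1 ((List.ofFn w.1).drop 1)
    have h3 := wordLen_append (m := m) 1 ((List.ofFn w.1).take 1) ((List.ofFn w.1).drop 1)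
    rw [List.take_append_drop] at h3
    simp only [List.length_drop, List.length_ofFn] at h2
    omega
  have hleg : Legal m v := by
    obtain ⟨y, hy, hv⟩ := hv
    obtain rfl : y = List.ofFn w.1 := hy
    exact w.2.of_mem_images hv
  rw [sum_mul_startsWith (hleg.mono (List.drop_suffix i v).isInfix) (by simp; omega)]
  exact hf _ (by simp; omega)

/-- The integral of a function of words of length `n` with respect to weights on legal words. -/
noncomputable def wsum {n : ℕ} (v : LegalWord m n → ℝ) (f : List Letter → ℝ) : ℝ :=
  ∑ w, v w * f (List.ofFn w.1)

theorem wsum_induced_one (hp : ∀ i, 0 ≤ p i) {n : ℕ} [NeZero n] {v : LegalWord m n → ℝ} {r : ℝ}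
    (hv : (inducedMatrix p n).mulVec v = r • v) {f : List Letter → ℝ}
    (hf : ∀ z, n ≤ z.length → f z = f (z.take n)) :
    wsum v (induced p 1 f) = r * wsum v f := by
  have hv' : ∀ u, ∑ w, inducedMatrix p n u w * v w = r * v u := fun u => congrFun hv u
  simp only [wsum, induced_eq_sum hp hf, Finset.mul_sum]
  rw [Finset.sum_comm]
  refine Finset.sum_congr rfl fun u _ => ?_
  rw [← mul_assoc, ← hv' u, Finset.sum_mul]
  exact Finset.sum_congr rfl fun w _ => by ring

/-- Weights that solve the eigenvector equation of the induced substitution are also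
self-similar with respect to all powers of the substitution. -/
theorem wsum_induced (hm : 1 ≤ m) (hp : ∀ i, 0 ≤ p i) (hsum : ∑ i, p i = 1) {n : ℕ} [NeZero n]
    {v : LegalWord m n → ℝ} {r : ℝ} (hv : (inducedMatrix p n).mulVec v = r • v) {B : ℝ}
    {f : List Letter → ℝ} (hf : IsLocal n B f) (k : ℕ) :
    wsum v (induced p k f) = r ^ k * wsum v f := by
  induction k with
  | zero =>
    simp only [wsum, pow_zero, one_mul]
    refine Finset.sum_congr rfl fun w _ => ?_
    have h0 : ((List.ofFn w.1).take 1).length = 1 := by simp [Nat.one_le_iff_ne_zero, NeZero.ne n]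
    simp [induced, h0, -List.length_take]
  | succ k ih =>
    have h1 := wsum_induced_one hp hv
      (hf.induced hm hp hsum (Nat.one_le_iff_ne_zero.2 (NeZero.ne n)) k).eq_take
    simp only [wsum, induced_succ hp hsum k] at h1 ih ⊢
    rw [h1, ih]
    ring

/-! ### Irreducibility -/

theorem exists_mem_iterImages_infix {k : ℕ} {u v w : List Letter} (h : u <:+: w)
    (hv : v ∈ iterImages m k u) : ∃ v' ∈ iterImages m k w, v <:+: v' := by
  obtain ⟨s, t, rfl⟩ := h
  obtain ⟨s', hs'⟩ := iterImages_nonempty (m := m) k s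
  obtain ⟨t', ht'⟩ := iterImages_nonempty (m := m) k t
  exact ⟨_, append_mem_iterImages (append_mem_iterImages hs' hv) ht', s', t', rfl⟩

theorem exists_mem_iterImages_one (hm : 1 ≤ m) (x : Letter) :
    ∃ v ∈ iterImages m 1 [Letter.a], [x] <:+: v := by
  refine ⟨_, ⟨_, rfl, letterImage_mem_images Letter.a 0⟩, ?_⟩
  obtain ⟨j, rfl⟩ : ∃ j, m = j + 1 := ⟨m - 1, by omega⟩
  cases x with
  | a => exact ⟨[Letter.b], List.replicate j Letter.a, by simp [letterImage, List.replicate_succ]⟩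
  | b => exact ⟨[], List.replicate (j + 1) Letter.a, by simp [letterImage]⟩

theorem exists_mem_iterImages_two (hm : 1 ≤ m) (x : Letter) :
    ∃ v ∈ iterImages m 2 [x], [Letter.b] <:+: v := by
  cases x with
  | a =>
    obtain ⟨v, hv, h⟩ := exists_mem_iterImages_one hm Letter.a
    obtain ⟨v', hv', h'⟩ := exists_mem_iterImages_one hm Letter.b
    obtain ⟨y, hy, hyv⟩ := exists_mem_iterImages_infix h hv'
    exact ⟨y, iterImages_trans hv hy, h'.trans hyv⟩
  | b =>
    obtain ⟨v', hv', h'⟩ := exists_mem_iterImages_one hm Letter.b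
    exact ⟨v', iterImages_trans a_mem_iterImages hv', h'⟩

/-- Every legal word occurs in images of both letters under a common power. -/
theorem Legal.exists_infix (hm : 1 ≤ m) {u : List Letter} (hu : Legal m u) :
    ∃ k, ∀ x : Letter, ∃ v ∈ iterImages m k [x], u <:+: v := by
  obtain ⟨k, -, w, hw, huw⟩ := hu
  refine ⟨2 + k, fun x => ?_⟩
  obtain ⟨v, hv, h⟩ := exists_mem_iterImages_two hm x
  obtain ⟨y, hy, hwy⟩ := exists_mem_iterImages_infix h hw
  exact ⟨y, iterImages_trans hv hy, huw.trans hwy⟩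

/-- The induced substitution is irreducible. -/
theorem exists_induced_startsWith_pos (hm : 1 ≤ m) (hpos : ∀ i, 0 < p i) {n : ℕ} [NeZero n]
    (u : LegalWord m n) : ∃ k, ∀ w : LegalWord m n,
      0 < induced p k (startsWith u.1) (List.ofFn w.1) := by
  obtain ⟨k, hk⟩ := u.2.exists_infix hm
  refine ⟨k, fun w => ?_⟩
  obtain ⟨l, rfl⟩ := Nat.exists_eq_succ_of_ne_zero (NeZero.ne n)
  rw [List.ofFn_succ]
  obtain ⟨v, hv, s, t, hst⟩ := hk (w.1 0)
  obtain ⟨v', hv'⟩ := iterImages_nonempty (m := m) k (List.ofFn fun i : Fin l => w.1 i.succ)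
  refine iterExpect_pos hpos (fun _ _ => Finset.sum_nonneg fun i _ => startsWith_nonneg _ _)
    (append_mem_iterImages hv hv') ?_
  have hl : s.length < wordLen m k [w.1 0] := by
    rw [← length_of_mem_iterImages hv, ← hst]
    simp
  refine Finset.sum_pos' (fun i _ => startsWith_nonneg _ _)
    ⟨s.length, by simpa using hl, ?_⟩
  simp [startsWith, ← hst]

theorem wsum_startsWith {n : ℕ} (v : LegalWord m n → ℝ) (u : LegalWord m n) :
    wsum v (startsWith u.1) = v u := by
  rw [wsum, Fintype.sum_eq_single u]
  · simp [startsWith]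
  · intro w hw
    have : w.1 ≠ u.1 := fun h => hw (Subtype.ext h)
    simp [startsWith, List.take_of_length_le, List.ofFn_inj, this]

/-- A nonnegative eigenvector of the induced substitution with a zero entry vanishes. -/
theorem eq_zero_of_mulVec_eq (hm : 1 ≤ m) (hpos : ∀ i, 0 < p i) (hsum : ∑ i, p i = 1) {n : ℕ}
    [NeZero n] {v : LegalWord m n → ℝ} {r : ℝ} (hv : (inducedMatrix p n).mulVec v = r • v)
    (h0 : ∀ w, 0 ≤ v w) {u : LegalWord m n} (hu : v u = 0) : v = 0 := by
  obtain ⟨k, hk⟩ := exists_induced_startsWith_pos hm hpos u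
  have h := wsum_induced hm (fun i => (hpos i).le) hsum hv (isLocal_startsWith u.1) k
  rw [wsum_startsWith, hu, mul_zero, wsum,
    Finset.sum_eq_zero_iff_of_nonneg fun w _ => mul_nonneg (h0 w) (hk w).le] at h
  funext w
  exact (mul_eq_zero.1 (h w (Finset.mem_univ w))).resolve_right (hk w).ne'

/-! ### Positive eigenvectors and the spectral radius -/

/-- A nonnegative matrix with a positive eigenvector has the corresponding eigenvalue as its
spectral radius. -/
theorem spectralRadius_eq_of_pos_eigenvector {ι : Type*} [Fintype ι] [DecidableEq ι] [Nonempty ι]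
    {M : Matrix ι ι ℝ} (hM : ∀ i j, 0 ≤ M i j) {R : ι → ℝ} (hR : ∀ i, 0 < R i) {r : ℝ}
    (hr : 0 ≤ r) (h : M.mulVec R = r • R) :
    (spectralRadius ℂ (M.map Complex.ofReal)).toReal = r := by
  have hmem (k : ℂ) : k ∈ spectrum ℂ (M.map Complex.ofReal) ↔
      ∃ v ≠ 0, (M.map Complex.ofReal).mulVec v = k • v := by
    rw [spectrum.mem_iff, Matrix.isUnit_iff_isUnit_det, isUnit_iff_ne_zero, not_not,
      ← Matrix.exists_mulVec_eq_zero_iff]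
    refine exists_congr fun v => and_congr_right fun _ => ?_
    rw [Matrix.sub_mulVec, sub_eq_zero, Algebra.algebraMap_eq_smul_one, Matrix.smul_mulVec,
      Matrix.one_mulVec, eq_comm]
  have e : spectralRadius ℂ (M.map Complex.ofReal) = ENNReal.ofReal r := by
    apply le_antisymm
    · refine iSup₂_le fun k hk => ?_
      obtain ⟨v, hv0, hv⟩ := (hmem k).1 hk
      -- compare an eigenvector `v` with `R` at an index where `‖v i‖ / R i` is maximal
      obtain ⟨i, -, hi⟩ := Finset.exists_max_image Finset.univ (fun i => ‖v i‖ / R i)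
        Finset.univ_nonempty
      set c := ‖v i‖ / R i with hc
      have hle (j : ι) : ‖v j‖ ≤ c * R j := (div_le_iff₀ (hR j)).1 (hi j (Finset.mem_univ j))
      have hc0 : 0 < c := by
        obtain ⟨j, hj⟩ := Function.ne_iff.1 hv0
        have : 0 < ‖v j‖ := norm_pos_iff.2 hj
        by_contra! hc'
        nlinarith [hle j, hR j]
      have h1 : ‖k‖ * ‖v i‖ ≤ c * (r * R i) := by
        have hvi : ∑ j, (M i j : ℂ) * v j = k * v i := congrFun hv i
        have hRi : ∑ j, M i j * R j = r * R i := congrFun h i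
        rw [← norm_mul, ← hvi, ← hRi, Finset.mul_sum]
        refine (norm_sum_le _ _).trans (Finset.sum_le_sum fun j _ => ?_)
        rw [norm_mul, Complex.norm_real, Real.norm_of_nonneg (hM i j)]
        nlinarith [hle j, hM i j]
      have h2 : ‖v i‖ = c * R i := by rw [hc, div_mul_cancel₀ _ (hR i).ne']
      have h3 : ‖k‖ ≤ r := by
        rw [h2] at h1
        have : 0 < c * R i := mul_pos hc0 (hR i)
        exact le_of_mul_le_mul_right (by linarith) this
      rw [← enorm_eq_nnnorm, ← ofReal_norm]
      exact ENNReal.ofReal_le_ofReal h3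
    · have hk : (r : ℂ) ∈ spectrum ℂ (M.map Complex.ofReal) := by
        refine (hmem r).2 ⟨fun i => (R i : ℂ), fun h0 => ?_, ?_⟩
        · have h1 : (R (Classical.arbitrary ι) : ℂ) = 0 := congrFun h0 _
          exact (hR (Classical.arbitrary ι)).ne' (by exact_mod_cast h1)
        · funext i
          have hRi : ∑ j, M i j * R j = r * R i := congrFun h i
          have : ∑ j, (M i j : ℂ) * R j = r * R i := by exact_mod_cast hRi
          exact this
      have := le_iSup₂ (f := fun k (_ : k ∈ spectrum ℂ (M.map Complex.ofReal)) => (‖k‖₊ : ENNReal))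
        (r : ℂ) hk
      refine le_trans (le_of_eq ?_) this
      rw [← enorm_eq_nnnorm, ← ofReal_norm, Complex.norm_real, Real.norm_of_nonneg hr]
  rw [e, ENNReal.toReal_ofReal hr]

/-! ### The frequency vector -/

open Classical in
/-- The frequency of a local function. -/
noncomputable def freq (p : Fin (m + 1) → ℝ) (g : List Letter → ℝ) : ℝ :=
  if h : ∃ ρ, HasFreq p g ρ then h.choose else 0

theorem IsLocal.hasFreq (hm : 1 ≤ m) (hp : ∀ i, 0 ≤ p i) (hsum : ∑ i, p i = 1) {n : ℕ} {B : ℝ}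
    {g : List Letter → ℝ} (hg : IsLocal n B g) : HasFreq p g (freq p g) := by
  have h : ∃ ρ, HasFreq p g ρ := hg.exists_hasFreq hm hp hsum
  rw [freq, dif_pos h]
  exact h.choose_spec

/-- The frequencies of the legal words of length `n`. -/
noncomputable def freqVec (p : Fin (m + 1) → ℝ) (n : ℕ) (w : LegalWord m n) : ℝ :=
  freq p (startsWith w.1)

/-- The frequency of a local function is its integral with respect to the word frequencies. -/
theorem hasFreq_wsum (hm : 1 ≤ m) (hp : ∀ i, 0 ≤ p i) (hsum : ∑ i, p i = 1) {n : ℕ} {B : ℝ}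
    {f : List Letter → ℝ} (hf : IsLocal n B f) : HasFreq p f (wsum (freqVec p n) f) := by
  have h1 : HasFreq p (fun z => ∑ u : LegalWord m n, f (List.ofFn u.1) * startsWith u.1 z)
      (∑ u : LegalWord m n, f (List.ofFn u.1) * freqVec p n u) :=
    HasFreq.sum _ fun u => ((isLocal_startsWith u.1).hasFreq hm hp hsum).const_mul _
  have h2 : wsum (freqVec p n) f = ∑ u : LegalWord m n, f (List.ofFn u.1) * freqVec p n u :=
    Finset.sum_congr rfl fun u _ => mul_comm _ _
  rw [h2]
  set S := ∑ u : LegalWord m n, |f (List.ofFn u.1)| with hS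
  have hS0 : 0 ≤ S := Finset.sum_nonneg fun _ _ => abs_nonneg _
  refine h1.congr hp hsum n (B := B + S) (fun z => ?_) (fun z => ?_) fun z hz hn =>
    (sum_mul_startsWith hz hn f).trans (hf.eq_take z hn).symm
  · refine le_trans ?_ (le_add_of_nonneg_left hf.nonneg)
    refine (Finset.abs_sum_le_sum_abs _ _).trans (Finset.sum_le_sum fun u _ => ?_)
    rw [abs_mul]
    exact mul_le_of_le_one_right (abs_nonneg _) ((isLocal_startsWith u.1).bound z)
  · exact (hf.bound z).trans (le_add_of_nonneg_right hS0)

theorem freqVec_nonneg (hm : 1 ≤ m) (hp : ∀ i, 0 ≤ p i) (hsum : ∑ i, p i = 1) {n : ℕ}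
    (w : LegalWord m n) : 0 ≤ freqVec p n w :=
  ((isLocal_startsWith w.1).hasFreq hm hp hsum).nonneg hm hp fun _ => startsWith_nonneg _ _

theorem sum_freqVec (hm : 1 ≤ m) (hp : ∀ i, 0 ≤ p i) (hsum : ∑ i, p i = 1) (n : ℕ) :
    ∑ w, freqVec p n w = 1 := by
  have h := hasFreq_wsum hm hp hsum (n := n) (B := 1) (f := fun _ => 1) ⟨by simp, by simp⟩
  simpa [wsum] using h.unique hm (HasFreq.one hp hsum)

/-- The word frequencies solve the eigenvector equation for the inflation factor. -/
theorem inducedMatrix_mulVec_freqVec (hm : 1 ≤ m) (hp : ∀ i, 0 ≤ p i) (hsum : ∑ i, p i = 1)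
    (n : ℕ) [NeZero n] :
    (inducedMatrix p n).mulVec (freqVec p n) = infl m • freqVec p n := by
  funext u
  have hl := isLocal_startsWith u.1
  have h1 := (hl.hasFreq hm hp hsum).induced hm hp hsum
  have h2 := hasFreq_wsum hm hp hsum
    (hl.induced hm hp hsum (Nat.one_le_iff_ne_zero.2 (NeZero.ne n)) 1)
  refine Eq.trans ?_ (h2.unique hm h1)
  simp only [wsum, induced_startsWith, Matrix.mulVec, dotProduct]
  exact Finset.sum_congr rfl fun w _ => mul_comm _ _

/-- The frequencies of words of different lengths and at different positions are consistent. -/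
theorem wsum_freqVec_drop (hm : 1 ≤ m) (hp : ∀ i, 0 ≤ p i) (hsum : ∑ i, p i = 1) {n n' j : ℕ}
    {B : ℝ} {f : List Letter → ℝ} (hf : IsLocal n B f) (hj : n + j ≤ n') :
    wsum (freqVec p n') (fun z => f (z.drop j)) = wsum (freqVec p n) f := by
  obtain ⟨h1, h2⟩ := (hasFreq_wsum hm hp hsum hf).drop hp hsum hf j
  exact (hasFreq_wsum hm hp hsum (h2.mono hj)).unique hm h1

theorem freqVec_pos (hm : 1 ≤ m) (hpos : ∀ i, 0 < p i) (hsum : ∑ i, p i = 1) {n : ℕ} [NeZero n]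
    (w : LegalWord m n) : 0 < freqVec p n w := by
  have hp := fun i => (hpos i).le
  refine (freqVec_nonneg hm hp hsum w).lt_of_ne fun h0 => ?_
  have h := eq_zero_of_mulVec_eq hm hpos hsum (inducedMatrix_mulVec_freqVec hm hp hsum n)
    (freqVec_nonneg hm hp hsum) h0.symm
  have := sum_freqVec hm hp hsum n
  simp [h] at this

theorem inducedMatrix_nonneg (hp : ∀ i, 0 ≤ p i) {n : ℕ} [NeZero n] (u w : LegalWord m n) :
    0 ≤ inducedMatrix p n u w :=
  Finset.sum_nonneg fun _ _ => mul_nonneg (Finset.prod_nonneg fun _ _ => hp _) (Nat.cast_nonneg _)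

theorem isPerronVector_freqVec (hm : 1 ≤ m) (hpos : ∀ i, 0 < p i) (hsum : ∑ i, p i = 1) (n : ℕ)
    [NeZero n] : IsPerronVector (inducedMatrix p n) (freqVec p n) := by
  have hp := fun i => (hpos i).le
  have hs := sum_freqVec hm hp hsum n
  have : Nonempty (LegalWord m n) := by
    by_contra h
    rw [not_nonempty_iff] at h
    simp at hs
  refine ⟨?_, freqVec_pos hm hpos hsum, hs⟩
  have h := inducedMatrix_mulVec_freqVec hm hp hsum n
  rw [spectralRadius_eq_of_pos_eigenvector (inducedMatrix_nonneg hp) (freqVec_pos hm hpos hsum)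
    (by linarith [one_lt_infl hm]) h, h]

/-- The normalised Perron–Frobenius eigenvector is unique. -/
theorem IsPerronVector.eq_freqVec (hm : 1 ≤ m) (hpos : ∀ i, 0 < p i) (hsum : ∑ i, p i = 1) {n : ℕ}
    [NeZero n] {R : LegalWord m n → ℝ} (hR : IsPerronVector (inducedMatrix p n) R) :
    R = freqVec p n := by
  have hF := isPerronVector_freqVec hm hpos hsum n
  have : Nonempty (LegalWord m n) := by
    by_contra h
    rw [not_nonempty_iff] at h
    simpa using hF.sum_eq_one
  -- the largest `c` with `c • freqVec p n ≤ R`: the difference has a zero entry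
  obtain ⟨i, -, hi⟩ := Finset.exists_min_image Finset.univ (fun i => R i / freqVec p n i)
    Finset.univ_nonempty
  set c := R i / freqVec p n i with hc
  have h0 : R - c • freqVec p n = 0 := by
    refine eq_zero_of_mulVec_eq hm hpos hsum (u := i)
      (r := (spectralRadius ℂ ((inducedMatrix p n).map Complex.ofReal)).toReal) ?_ (fun w => ?_) ?_
    · rw [Matrix.mulVec_sub, Matrix.mulVec_smul, hR.eigen, hF.eigen, smul_sub, smul_comm]
    · have := (le_div_iff₀ (hF.pos w)).1 (hi w (Finset.mem_univ w))
      simpa using this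
    · have := (hF.pos i).ne'
      simp [hc, this]
  have h1 : R = c • freqVec p n := sub_eq_zero.1 h0
  have h2 := hR.sum_eq_one
  rw [h1] at h2
  simp only [Pi.smul_apply, smul_eq_mul, ← Finset.mul_sum, hF.sum_eq_one, mul_one] at h2
  rw [h1, h2, one_smul]

/-! ### Concentration of empirical frequencies -/

/-- The deviation of the sum of `g` over the suffixes of a word from its expected value. -/
noncomputable def deviation (g : List Letter → ℝ) (ρ : ℝ) (z : List Letter) : ℝ :=
  occ g z - ρ * z.length

theorem abs_deviation_append_sub_le {n : ℕ} {B : ℝ} {g : List Letter → ℝ} (hg : IsLocal n B g)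
    (ρ : ℝ) (y z : List Letter) :
    |deviation g ρ (y ++ z) - deviation g ρ y - deviation g ρ z| ≤ n * (2 * B) := by
  convert abs_occ_append_sub_le hg y z using 2
  simp only [deviation, List.length_append]
  push_cast
  ring

theorem abs_deviation_le {n : ℕ} {B : ℝ} {g : List Letter → ℝ} (hg : IsLocal n B g)
    (ρ : ℝ) (z : List Letter) : |deviation g ρ z| ≤ (B + |ρ|) * z.length := by
  have h1 : |occ g z| ≤ z.length * B := by
    refine (Finset.abs_sum_le_sum_abs _ _).trans ?_
    refine (Finset.sum_le_card_nsmul _ _ B fun i _ => hg.bound _).trans ?_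
    simp
  refine (abs_sub _ _).trans ?_
  rw [abs_mul, Nat.abs_cast]
  linarith

theorem iterExpect_deviation (hp : ∀ i, 0 ≤ p i) (hsum : ∑ i, p i = 1) (g : List Letter → ℝ)
    (ρ : ℝ) (k : ℕ) (w : List Letter) :
    iterExpect p k w (deviation g ρ) = iterExpect p k w (occ g) - ρ * wordLen m k w := by
  rw [← iterExpect_sub_const hsum]
  exact iterExpect_congr hp fun v hv => by rw [deviation, length_of_mem_iterImages hv]

theorem wordLen_le (hm : 1 ≤ m) (k : ℕ) (w : List Letter) :
    wordLen m k w ≤ w.length * inflLen m k Letter.a := by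
  induction w with
  | nil => simp
  | cons x w ih =>
    have := inflLen_le hm k x
    simp only [wordLen_cons, List.length_cons]
    linarith

theorem length_mul_inflLen_le (hm : 1 ≤ m) (k : ℕ) (w : List Letter) :
    w.length * inflLen m k Letter.a ≤ (m + 1) * wordLen m k w := by
  induction w with
  | nil => simp
  | cons x w ih =>
    have := inflLen_a_le hm k x
    simp only [wordLen_cons, List.length_cons]
    linarith

theorem abs_iterExpect_deviation_le (hp : ∀ i, 0 ≤ p i) (hsum : ∑ i, p i = 1) {n : ℕ} {B : ℝ}
    {g : List Letter → ℝ} (hg : IsLocal n B g) {ρ C : ℝ}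
    (hC : ∀ k x, |iterExpect p k [x] (occ g) - ρ * inflLen m k x| ≤ C) (k : ℕ)
    (w : List Letter) :
    |iterExpect p k w (deviation g ρ)| ≤ w.length * (C + n * (2 * B)) := by
  rw [iterExpect_deviation hp hsum]
  have h1 := abs_iterExpect_occ_sub_sum_le hp hsum hg k w
  have h2 : |(w.map fun x => iterExpect p k [x] (occ g)).sum - ρ * wordLen m k w| ≤
      w.length * C := by
    induction w with
    | nil => simp
    | cons x w ih =>
      have h3 := ih (abs_iterExpect_occ_sub_sum_le hp hsum hg k w)
      have h4 := hC k x
      simp only [List.map_cons, List.sum_cons, List.length_cons, wordLen_cons]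
      push_cast
      rw [abs_le] at *
      constructor <;> linarith [h3.1, h3.2, h4.1, h4.2]
  rw [abs_le] at *
  constructor <;> linarith [h1.1, h1.2, h2.1, h2.2]

/-- The second moment of the deviation: images of different letters are independent and their mean
deviations are bounded, so that the deviation of the image of a word of length `r` under the `k`-th
power is of smaller order than the length of this image, for large `k` and `r`. -/
theorem iterExpect_deviation_sq_le (hm : 1 ≤ m) (hp : ∀ i, 0 ≤ p i) (hsum : ∑ i, p i = 1)
    {n : ℕ} {B : ℝ} {g : List Letter → ℝ} (hg : IsLocal n B g) {ρ C : ℝ}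
    (hC : ∀ k x, |iterExpect p k [x] (occ g) - ρ * inflLen m k x| ≤ C) :
    ∃ K A : ℝ, 0 ≤ K ∧ 0 ≤ A ∧ ∀ k w, iterExpect p k w (fun z => deviation g ρ z ^ 2) ≤
      w.length * (K * (inflLen m k Letter.a : ℝ) ^ 2) +
        (w.length : ℝ) ^ 2 * (A * inflLen m k Letter.a) := by
  have hB := hg.nonneg
  have hC0 : 0 ≤ C := (abs_nonneg _).trans (hC 0 Letter.a)
  set D : ℝ := n * (2 * B) with hD
  have hD0 : 0 ≤ D := by positivity
  set κ := B + |ρ| with hκ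
  have hκ0 : 0 ≤ κ := by positivity
  refine ⟨κ ^ 2, C * (C + D) + 2 * D * κ + D ^ 2, by positivity, by positivity, fun k w => ?_⟩
  set A := C * (C + D) + 2 * D * κ + D ^ 2 with hA
  have hT : (1 : ℝ) ≤ inflLen m k Letter.a := by exact_mod_cast inflLen_pos (m := m) k Letter.a
  set T : ℝ := (inflLen m k Letter.a : ℝ) with hTdef
  induction w with
  | nil =>
    rw [iterExpect_congr hp (g := fun _ => (0 : ℝ)) fun v hv => ?_, iterExpect_const hsum]
    · simp
    · have := length_of_mem_iterImages hv
      simp only [wordLen_nil, List.length_eq_zero_iff] at this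
      simp [this, deviation, occ]
  | cons x w ih =>
    set r : ℝ := (w.length : ℝ) with hr
    have hr0 : 0 ≤ r := Nat.cast_nonneg _
    have hx : ∀ y ∈ iterImages m k [x], |deviation g ρ y| ≤ κ * T := by
      intro y hy
      refine (abs_deviation_le hg ρ y).trans (mul_le_mul_of_nonneg_left ?_ hκ0)
      rw [length_of_mem_iterImages hy]
      have := inflLen_le hm k x
      simpa [hTdef] using this
    have hw : ∀ y ∈ iterImages m k w, |deviation g ρ y| ≤ κ * (r * T) := by
      intro y hy
      refine (abs_deviation_le hg ρ y).trans (mul_le_mul_of_nonneg_left ?_ hκ0)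
      rw [length_of_mem_iterImages hy]
      have := wordLen_le hm k w
      rw [hr, hTdef]
      exact_mod_cast this
    set E := iterExpect p k w (deviation g ρ) with hE
    set Q := iterExpect p k w (fun z => deviation g ρ z ^ 2) with hQ
    set G := κ ^ 2 * T ^ 2 + 2 * D * (κ * T + κ * (r * T)) + D ^ 2 with hG
    have hpt : ∀ y ∈ iterImages m k [x], ∀ z ∈ iterImages m k w,
        deviation g ρ (y ++ z) ^ 2 ≤
          deviation g ρ z ^ 2 + (2 * deviation g ρ y) * deviation g ρ z + G := by
      intro y hy z hz
      have h1 := abs_deviation_append_sub_le hg ρ y z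
      rw [← hD] at h1
      have h2 := hx y hy
      have h3 := hw z hz
      set e := deviation g ρ (y ++ z) - deviation g ρ y - deviation g ρ z with he
      have e1 : deviation g ρ (y ++ z) = deviation g ρ y + deviation g ρ z + e := by
        rw [he]; ring
      have h4 : deviation g ρ y ^ 2 ≤ κ ^ 2 * T ^ 2 := by
        rw [← mul_pow]; exact sq_le_sq' (abs_le.1 h2).1 (abs_le.1 h2).2
      have h5 : e ^ 2 ≤ D ^ 2 := sq_le_sq' (abs_le.1 h1).1 (abs_le.1 h1).2
      have h6 : e * (deviation g ρ y + deviation g ρ z) ≤ D * (κ * T + κ * (r * T)) := by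
        refine (le_abs_self _).trans ?_
        rw [abs_mul]
        exact mul_le_mul h1 ((abs_add_le _ _).trans (add_le_add h2 h3)) (abs_nonneg _) hD0
      rw [e1]
      linarith
    -- the images of `x` and `w` are independent, which factorises the mixed term
    have hstep : iterExpect p k (x :: w) (fun z => deviation g ρ z ^ 2) ≤
        Q + 2 * (iterExpect p k [x] (deviation g ρ) * E) + G := by
      rw [← List.singleton_append, iterExpect_append]
      have h1 : iterExpect p k [x] (fun y => Q + (2 * deviation g ρ y) * E + G) =
          Q + 2 * (iterExpect p k [x] (deviation g ρ) * E) + G := by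
        have : (fun y => Q + (2 * deviation g ρ y) * E + G) =
            (fun _ => Q + G) + (2 * E) • deviation g ρ := by
          funext y; simp only [Pi.add_apply, Pi.smul_apply, smul_eq_mul]; ring
        rw [this, map_add, map_smul, iterExpect_const hsum, smul_eq_mul]
        ring
      rw [← h1]
      refine iterExpect_mono hp fun y hy => ?_
      refine (iterExpect_mono hp (hpt y hy)).trans (le_of_eq ?_)
      have : (fun z => deviation g ρ z ^ 2 + (2 * deviation g ρ y) * deviation g ρ z + G) =
          (fun z => deviation g ρ z ^ 2) + (2 * deviation g ρ y) • deviation g ρ + fun _ => G := by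
        funext z; simp
      rw [this, map_add, map_add, map_smul, iterExpect_const hsum, smul_eq_mul]
    have hcross : iterExpect p k [x] (deviation g ρ) * E ≤ C * (r * (C + D)) := by
      refine (le_abs_self _).trans ?_
      rw [abs_mul]
      refine mul_le_mul ?_ (abs_iterExpect_deviation_le hp hsum hg hC k w) (abs_nonneg _) hC0
      rw [iterExpect_deviation hp hsum]
      simpa using hC k x
    refine hstep.trans ?_
    have hcd : 0 ≤ C * (C + D) := by positivity
    have hdk : 0 ≤ D * κ := by positivity
    have hdd : 0 ≤ D ^ 2 := by positivity
    simp only [List.length_cons, Nat.cast_add, Nat.cast_one, ← hr]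
    have i1 : r * (C * (C + D)) ≤ r * (C * (C + D)) * T :=
      le_mul_of_one_le_right (by positivity) hT
    have i2 : D ^ 2 ≤ D ^ 2 * T := le_mul_of_one_le_right hdd hT
    have i3 : 0 ≤ C * (C + D) * T := by positivity
    have i4 : 0 ≤ r * (D * κ * T) := by positivity
    have i5 : 0 ≤ r * (D ^ 2 * T) := by positivity
    rw [hG, hA]
    rw [hA] at ih
    linarith

/-- A prefix of a word can be chosen such that the length of its image is at least `n`, but not
much larger. -/
theorem exists_wordLen_split (hm : 1 ≤ m) (k n : ℕ) (w : List Letter) (hn : n ≤ w.length) :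
    ∃ y z, w = y ++ z ∧ n ≤ wordLen m k y ∧ wordLen m k y ≤ n + inflLen m k Letter.a := by
  induction w generalizing n with
  | nil => exact ⟨[], [], by simp, by simpa using hn, by simp⟩
  | cons x w ih =>
    have hx := inflLen_le hm k x
    have hx' := inflLen_pos (m := m) k x
    rcases le_total n (inflLen m k x) with h | h
    · exact ⟨[x], w, rfl, by simpa using h, by simp; omega⟩
    · simp only [List.length_cons] at hn
      obtain ⟨y, z, rfl, h1, h2⟩ := ih (n - inflLen m k x) (by omega)
      exact ⟨x :: y, z, rfl, by simp; omega, by simp; omega⟩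

/-- The sum of `g` over `n` consecutive suffixes, compared with its expected value. -/
theorem abs_window_sub_le {l : ℕ} {B : ℝ} {g : List Letter → ℝ} (hg : IsLocal l B g) (ρ : ℝ)
    {n T j : ℕ} {y z : List Letter} (hn : n ≤ y.length) (hT : y.length ≤ n + T) (hj : j ≤ T) :
    |∑ i ∈ Finset.range n, g (((y ++ z).drop j).drop i) - n * ρ| ≤
      |deviation g ρ y| + ((2 * B + |ρ|) * T + l * (2 * B)) := by
  have hB := hg.nonneg
  have hsum (f : ℕ → ℝ) (hf : ∀ i, |f i| ≤ B) (q : ℕ) (hq : q ≤ T) :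
      |∑ i ∈ Finset.range q, f i| ≤ B * T := by
    refine (Finset.abs_sum_le_sum_abs _ _).trans ?_
    refine (Finset.sum_le_card_nsmul _ _ B fun i _ => hf i).trans ?_
    rw [Finset.card_range, nsmul_eq_mul, mul_comm]
    gcongr
  set S : ℕ → ℝ := fun q => ∑ i ∈ Finset.range q, g ((y ++ z).drop i) with hS
  have hSadd (q r : ℕ) : S (q + r) = S q + ∑ i ∈ Finset.range r, g ((y ++ z).drop (q + i)) := by
    simp only [hS, Finset.sum_range_add]
  have h1 : ∑ i ∈ Finset.range n, g (((y ++ z).drop j).drop i) = S (j + n) - S j := by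
    rw [hSadd]; simp [List.drop_drop]
  have h2 : |S j| ≤ B * T := hsum _ (fun i => hg.bound _) j hj
  have h3 : |S (j + n) - S y.length| ≤ B * T := by
    rcases le_total (j + n) y.length with h | h
    · obtain ⟨d, hd⟩ := Nat.exists_eq_add_of_le h
      rw [abs_sub_comm, hd, hSadd, add_sub_cancel_left]
      exact hsum _ (fun i => hg.bound _) d (by omega)
    · obtain ⟨d, hd⟩ := Nat.exists_eq_add_of_le h
      rw [hd, hSadd, add_sub_cancel_left]
      exact hsum _ (fun i => hg.bound _) d (by omega)
  have h4 : |S y.length - occ g y| ≤ l * (2 * B) := by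
    have h := abs_occ_append_sub_le hg y z
    have e : occ g (y ++ z) = S y.length + occ g z := by
      rw [occ, List.length_append, Finset.sum_range_add, occ]
      simp only [drop_length_add_append, hS]
    rw [e] at h
    convert h using 2
    ring
  have h5 : |ρ * (y.length - n : ℝ)| ≤ |ρ| * T := by
    rw [abs_mul]
    refine mul_le_mul_of_nonneg_left ?_ (abs_nonneg ρ)
    have h6 : (n : ℝ) ≤ y.length := by exact_mod_cast hn
    have h7 : (y.length : ℝ) ≤ n + T := by exact_mod_cast hT
    rw [abs_le]
    constructor <;> linarith
  have e : ∑ i ∈ Finset.range n, g (((y ++ z).drop j).drop i) - n * ρ =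
      deviation g ρ y - S j + (S (j + n) - S y.length) + (S y.length - occ g y) +
        ρ * (y.length - n : ℝ) := by
    rw [h1, deviation]; ring
  rw [e]
  have a1 := abs_add_le (deviation g ρ y - S j + (S (j + n) - S y.length) +
    (S y.length - occ g y)) (ρ * (y.length - n : ℝ))
  have a2 := abs_add_le (deviation g ρ y - S j + (S (j + n) - S y.length)) (S y.length - occ g y)
  have a3 := abs_add_le (deviation g ρ y - S j) (S (j + n) - S y.length)
  have a4 := abs_sub (deviation g ρ y) (S j)
  linarith

/-- The absolute deviation of the average of `g` over `n` consecutive suffixes from `ρ`,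
multiplied by `n`. -/
noncomputable def windowDev (g : List Letter → ℝ) (ρ : ℝ) (n : ℕ) (z : List Letter) : ℝ :=
  |∑ i ∈ Finset.range n, g (z.drop i) - n * ρ|

theorem IsLocal.windowDev {l : ℕ} {B : ℝ} {g : List Letter → ℝ} (hg : IsLocal l B g) (ρ : ℝ)
    (n : ℕ) : IsLocal (n + l) (n * (B + |ρ|)) (windowDev g ρ n) where
  eq_take z hz := by
    unfold RNMS.windowDev
    congr 2
    refine Finset.sum_congr rfl fun i hi => ?_
    have hi' := Finset.mem_range.1 hi
    rw [hg.eq_take (z.drop i) (by simp; omega), hg.eq_take ((z.take (n + l)).drop i)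
      (by simp; omega), List.drop_take, List.take_take, min_eq_left (by omega)]
  bound z := by
    rw [RNMS.windowDev, abs_abs]
    refine (abs_sub _ _).trans ?_
    rw [abs_mul, Nat.abs_cast, mul_add]
    gcongr
    refine (Finset.abs_sum_le_sum_abs _ _).trans ?_
    refine (Finset.sum_le_card_nsmul _ _ B fun i _ => hg.bound _).trans ?_
    simp

/-- Under the frequency vectors, averages of a local function over long windows are close to its
frequency in mean. The self-similarity of the frequency vector reduces this to windows in images
under a high power, where the second moment bound applies. -/
theorem exists_wsum_windowDev_le (hm : 1 ≤ m) (hp : ∀ i, 0 ≤ p i) (hsum : ∑ i, p i = 1)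
    {l : ℕ} {B : ℝ} {g : List Letter → ℝ} (hg : IsLocal l B g) {ρ : ℝ} (hρ : HasFreq p g ρ)
    {η : ℝ} (hη : 0 < η) :
    ∃ n : ℕ, 1 ≤ n ∧ wsum (freqVec p (n + l)) (windowDev g ρ n) ≤ η * n := by
  have hB := hg.nonneg
  obtain ⟨C, hC⟩ := hρ
  obtain ⟨K, A, hK, hA, hKA⟩ := iterExpect_deviation_sq_le hm hp hsum hg hC
  set M : ℝ := 2 * (m + 1) with hM
  have hM0 : 0 < M := by positivity
  -- first choose the power `k`, so that the relative boundary errors are small, and then a window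
  -- length `n` that is large compared with the images under this power
  obtain ⟨k, hk⟩ := ((tendsto_inflLen hm).eventually_ge_atTop (4 * (M ^ 2 * A) / η ^ 2)).exists
  have hT1 : (1 : ℝ) ≤ inflLen m k Letter.a := by exact_mod_cast inflLen_pos (m := m) k Letter.a
  set T := inflLen m k Letter.a with hT
  have hT0 : (0 : ℝ) < T := by linarith
  set W : ℝ := (2 * B + |ρ|) * T + l * (2 * B) with hW
  obtain ⟨n, hn⟩ := exists_nat_ge ((T : ℝ) + 4 * W / η + 4 * (M * K * T) / η ^ 2)
  have hW0 : 0 ≤ W := by positivity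
  have n1 : 0 ≤ 4 * W / η := by positivity
  have n2 : 0 ≤ 4 * (M * K * T) / η ^ 2 := by positivity
  have hnT : (T : ℝ) ≤ n := by linarith
  have hn0 : (0 : ℝ) < n := by linarith
  have hn1 : 1 ≤ n := by exact_mod_cast hn0
  refine ⟨n, hn1, ?_⟩
  have : NeZero (n + l) := ⟨by omega⟩
  have hnW : 4 * W ≤ η * n := by
    have : 4 * W / η ≤ n := by linarith
    rw [div_le_iff₀ hη] at this
    linarith
  have hnK : 4 * (M * K * T) ≤ η ^ 2 * n := by
    have : 4 * (M * K * T) / η ^ 2 ≤ n := by linarith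
    rw [div_le_iff₀ (by positivity)] at this
    linarith
  have hTA : 4 * (M ^ 2 * A) ≤ η ^ 2 * T := by
    rw [div_le_iff₀ (by positivity)] at hk
    linarith
  -- the bound for a window that starts in the image of the first letter
  have key : ∀ w : List Letter, n ≤ w.length → ∀ j < T,
      iterExpect p k w (fun v => windowDev g ρ n (v.drop j)) ≤ η * n := by
    intro w hw j hj
    obtain ⟨y, z, rfl, h1, h2⟩ := exists_wordLen_split hm k n w hw
    rw [iterExpect_append]
    have hpt : ∀ v ∈ iterImages m k y, iterExpect p k z
        (fun v' => windowDev g ρ n ((v ++ v').drop j)) ≤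
        (1 / (2 * (η * n))) * deviation g ρ v ^ 2 + (η * n / 2 + W) := by
      intro v hv
      rw [← iterExpect_const (p := p) hsum k z ((1 / (2 * (η * n))) * deviation g ρ v ^ 2 + _)]
      refine iterExpect_mono hp fun v' _ => ?_
      have hl := length_of_mem_iterImages hv
      refine (abs_window_sub_le hg ρ (T := T) (by omega) (by omega) hj.le).trans ?_
      have hs : 0 < η * n := by positivity
      -- the inequality of the arithmetic and geometric means bounds the first absolute moment
      have : |deviation g ρ v| ≤ (1 / (2 * (η * n))) * deviation g ρ v ^ 2 + η * n / 2 := by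
        rw [← sq_abs (deviation g ρ v)]
        have e : (1 / (2 * (η * n))) * |deviation g ρ v| ^ 2 + η * n / 2 - |deviation g ρ v| =
            (1 / (2 * (η * n))) * (|deviation g ρ v| - η * n) ^ 2 := by
          field_simp
          ring
        have : 0 ≤ (1 / (2 * (η * n))) * (|deviation g ρ v| - η * n) ^ 2 := by positivity
        linarith
      linarith
    refine (iterExpect_mono hp hpt).trans ?_
    have e : (fun v => (1 / (2 * (η * n))) * deviation g ρ v ^ 2 + (η * n / 2 + W)) =
        (1 / (2 * (η * n))) • (fun v => deviation g ρ v ^ 2) + fun _ => η * n / 2 + W := by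
      funext v; simp
    rw [e, map_add, map_smul, iterExpect_const hsum, smul_eq_mul]
    have hlen : (y.length : ℝ) * T ≤ M * n := by
      have h3 : (y.length : ℝ) * T ≤ (m + 1) * wordLen m k y := by
        exact_mod_cast length_mul_inflLen_le hm k y
      have h4 : (wordLen m k y : ℝ) ≤ n + T := by exact_mod_cast h2
      have h5 : ((m : ℝ) + 1) * wordLen m k y ≤ (m + 1) * (n + n) := by gcongr; linarith
      rw [hM]; linarith
    have hq := hKA k y
    have q1 : (y.length : ℝ) * (K * (T : ℝ) ^ 2) ≤ η ^ 2 * n ^ 2 / 4 := by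
      have : (y.length * T : ℝ) * (K * T) ≤ M * n * (K * T) := by gcongr
      have h6 := mul_le_mul_of_nonneg_left hnK hn0.le
      linarith
    have q2 : (y.length : ℝ) ^ 2 * (A * T) ≤ η ^ 2 * n ^ 2 / 4 := by
      have h6 : ((y.length : ℝ) * T) ^ 2 * A ≤ (M * n) ^ 2 * A := by gcongr
      have h7 : (y.length : ℝ) ^ 2 * (A * T) * T ≤ η ^ 2 * n ^ 2 / 4 * T := by
        have h8 := mul_le_mul_of_nonneg_left hTA (sq_nonneg (n : ℝ))
        linarith
      exact le_of_mul_le_mul_right h7 hT0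
    have q3 : (1 / (2 * (η * n))) * iterExpect p k y (fun v => deviation g ρ v ^ 2) ≤
        η * n / 4 := by
      rw [one_div, inv_mul_le_iff₀ (by positivity)]
      linarith
    linarith
  have h1 := wsum_induced hm hp hsum (inducedMatrix_mulVec_freqVec hm hp hsum (n + l))
    (hg.windowDev ρ n) k
  have h2 := wsum_induced hm hp hsum (inducedMatrix_mulVec_freqVec hm hp hsum (n + l))
    (f := fun _ => 1) (B := 1) ⟨by simp, by simp⟩ k
  have h3 : wsum (freqVec p (n + l)) (fun _ => 1) = 1 := by
    simpa [wsum] using sum_freqVec hm hp hsum (n + l)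
  have h4 : wsum (freqVec p (n + l)) (induced p k (windowDev g ρ n)) ≤
      η * n * wsum (freqVec p (n + l)) (induced p k fun _ => 1) := by
    rw [wsum, wsum, Finset.mul_sum]
    refine Finset.sum_le_sum fun w _ => ?_
    have : induced p k (windowDev g ρ n) (List.ofFn w.1) ≤
        η * n * induced p k (fun _ => 1) (List.ofFn w.1) := by
      have e : (fun v => ∑ i ∈ Finset.range (wordLen m k ((List.ofFn w.1).take 1)),
          windowDev g ρ n (List.drop i v)) =
          ∑ i ∈ Finset.range (wordLen m k ((List.ofFn w.1).take 1)), fun v =>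
            windowDev g ρ n (List.drop i v) := by
        funext v; simp
      rw [induced, induced, e, map_sum]
      simp only [Finset.sum_const, Finset.card_range, nsmul_eq_mul, mul_one,
        iterExpect_const hsum]
      refine (Finset.sum_le_card_nsmul _ _ (η * n) fun i hi => key _ (by simp) i ?_).trans ?_
      · exact (Finset.mem_range.1 hi).trans_le (wordLen_take_one_le hm k _)
      · rw [Finset.card_range, nsmul_eq_mul, mul_comm]
    calc _ ≤ freqVec p (n + l) w * (η * n * induced p k (fun _ => 1) (List.ofFn w.1)) :=
          mul_le_mul_of_nonneg_left this (freqVec_nonneg hm hp hsum w)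
      _ = _ := by ring
  rw [h1, h2, h3] at h4
  have hpow : 0 < infl m ^ k := pow_pos (by linarith [one_lt_infl hm]) k
  exact le_of_mul_le_mul_left (by linarith) hpow

/-! ### The pointwise ergodic theorem -/

section Birkhoff

variable {α : Type*} {T : α → α}

/-- The maximum of `0` and the Birkhoff sums of `f` of length at most `n`, by the recursion that
drives the maximal ergodic argument. -/
noncomputable def maxSum (T : α → α) (f : α → ℝ) : ℕ → α → ℝ
  | 0, _ => 0
  | n + 1, x => max 0 (f x + maxSum T f n (T x))

theorem maxSum_nonneg (f : α → ℝ) (n : ℕ) (x : α) : 0 ≤ maxSum T f n x := by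
  cases n with
  | zero => exact le_rfl
  | succ n => exact le_max_left _ _

theorem maxSum_le_succ (f : α → ℝ) (n : ℕ) (x : α) : maxSum T f n x ≤ maxSum T f (n + 1) x := by
  induction n generalizing x with
  | zero => exact maxSum_nonneg f 1 x
  | succ n ih => exact max_le_max le_rfl (by linarith [ih (T x)])

theorem birkhoffSum_le_maxSum (f : α → ℝ) (n : ℕ) (x : α) :
    birkhoffSum T f n x ≤ maxSum T f n x := by
  induction n generalizing x with
  | zero => simp [maxSum]
  | succ n ih =>
    rw [birkhoffSum_succ']
    exact le_max_of_le_right (by linarith [ih (T x)])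

variable [MeasurableSpace α] {μ : Measure α}

theorem integrable_maxSum (hT : MeasurePreserving T μ μ) {f : α → ℝ} (hf : Integrable f μ)
    (n : ℕ) : Integrable (maxSum T f n) μ := by
  induction n with
  | zero => exact integrable_zero _ _ _
  | succ n ih =>
    exact (integrable_zero α ℝ μ).sup (hf.add (hT.integrable_comp_of_integrable ih))

theorem measurable_maxSum (hT : Measurable T) {f : α → ℝ} (hf : Measurable f) (n : ℕ) :
    Measurable (maxSum T f n) := by
  induction n with
  | zero => exact measurable_const
  | succ n ih => exact measurable_const.max (hf.add (ih.comp hT))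

/-- Birkhoff sums of a function with negative integral are bounded above almost everywhere. -/
theorem ae_exists_birkhoffSum_le [IsFiniteMeasure μ] (hT : Ergodic T μ) {f : α → ℝ}
    (hfm : Measurable f) (hf : Integrable f μ) (hneg : ∫ x, f x ∂μ < 0) :
    ∀ᵐ x ∂μ, ∃ b : ℝ, ∀ n, birkhoffSum T f n x ≤ b := by
  -- the set where the Birkhoff sums may be unbounded is invariant
  set A : Set α := {x | ∀ b : ℕ, ∃ n, (b : ℝ) < maxSum T f n x} with hA
  have hAm : MeasurableSet A := by
    have : A = ⋂ b : ℕ, ⋃ n, {x | (b : ℝ) < maxSum T f n x} := by ext; simp [hA]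
    rw [this]
    exact MeasurableSet.iInter fun b => MeasurableSet.iUnion fun n =>
      measurableSet_lt measurable_const (measurable_maxSum hT.measurable hfm n)
  have hmono (x : α) : Monotone fun n => maxSum T f n x :=
    monotone_nat_of_le_succ fun n => maxSum_le_succ f n x
  have hAinv : T ⁻¹' A = A := by
    ext x
    constructor
    · intro h b
      obtain ⟨c, hc⟩ := exists_nat_ge ((b : ℝ) - f x)
      obtain ⟨n, hn⟩ := h c
      exact ⟨n + 1, lt_max_of_lt_right (by linarith)⟩
    · intro h b
      obtain ⟨c, hc⟩ := exists_nat_ge (max 0 (f x + b))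
      obtain ⟨n, hn⟩ := h c
      refine ⟨n, ?_⟩
      have h1 := (max_le_iff.1 hc)
      have h2 : max 0 (f x + b) < maxSum T f (n + 1) x :=
        hc.trans_lt (hn.trans_le (maxSum_le_succ f n x))
      rcases lt_max_iff.1 h2 with h3 | h3
      · exact absurd h3 (not_lt.2 (le_max_left _ _))
      · linarith [le_max_right 0 (f x + (b : ℝ))]
  have htop (x : α) (hx : x ∈ A) : Tendsto (fun n => maxSum T f n x) atTop atTop := by
    refine tendsto_atTop_atTop_of_monotone (hmono x) fun b => ?_
    obtain ⟨c, hc⟩ := exists_nat_ge b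
    obtain ⟨n, hn⟩ := hx c
    exact ⟨n, hc.trans hn.le⟩
  have hpres := hT.toMeasurePreserving
  -- `maxSum` increases with `n` and its integral over the invariant set `A` is shift invariant
  have hdiff (n : ℕ) : 0 ≤ ∫ x in A, max (-maxSum T f n (T x)) (f x) ∂μ := by
    have e : ∀ x, max (-maxSum T f n (T x)) (f x) = maxSum T f (n + 1) x - maxSum T f n (T x) := by
      intro x
      rw [maxSum, max_sub_sub_right 0 (f x + _) (maxSum T f n (T x)) |>.symm]
      simp
    simp only [e]
    have i1 := (integrable_maxSum hpres hf (n + 1)).integrableOn (s := A)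
    have i2 : IntegrableOn (fun x => maxSum T f n (T x)) A μ :=
      (hpres.integrable_comp_of_integrable (integrable_maxSum hpres hf n)).integrableOn
    rw [integral_sub i1 i2]
    have h1 : ∫ x in A, (maxSum T f n ∘ T) x ∂μ = ∫ x in A, maxSum T f n x ∂μ := by
      have hres : MeasurePreserving T (μ.restrict A) (μ.restrict A) := by
        have := hpres.restrict_preimage hAm
        rwa [hAinv] at this
      conv_rhs => rw [← hres.map_eq]
      rw [integral_map hres.measurable.aemeasurable
        (measurable_maxSum hT.measurable hfm n).aestronglyMeasurable]
      rfl
    have h2 : ∫ x in A, maxSum T f n x ∂μ ≤ ∫ x in A, maxSum T f (n + 1) x ∂μ :=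
      integral_mono (integrable_maxSum hpres hf n).integrableOn i1 fun x => maxSum_le_succ f n x
    simp only [Function.comp_apply] at h1
    linarith
  have hlim : Tendsto (fun n => ∫ x in A, max (-maxSum T f n (T x)) (f x) ∂μ) atTop
      (𝓝 (∫ x in A, f x ∂μ)) := by
    refine tendsto_integral_of_dominated_convergence (fun x => |f x|) (fun n => ?_)
      hf.abs.integrableOn (fun n => ?_) ?_
    · exact (((measurable_maxSum hT.measurable hfm n).comp hT.measurable).neg.max
        hfm).aestronglyMeasurable
    · refine Eventually.of_forall fun x => ?_
      rw [Real.norm_eq_abs, abs_le]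
      have := maxSum_nonneg (T := T) f n (T x)
      exact ⟨(neg_abs_le _).trans (le_max_right _ _),
        max_le (by linarith [abs_nonneg (f x)]) (le_abs_self _)⟩
    · refine (ae_restrict_iff' hAm).2 (Eventually.of_forall fun x hx => ?_)
      rw [← hAinv] at hx
      refine tendsto_const_nhds.congr' ?_
      filter_upwards [(htop (T x) hx).eventually_ge_atTop (-f x)] with n hn
      rw [max_eq_right (by linarith)]
  have hA0 : 0 ≤ ∫ x in A, f x ∂μ := ge_of_tendsto' hlim hdiff
  have hnot : ∀ᵐ x ∂μ, x ∉ A := by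
    refine (hT.ae_mem_or_ae_notMem hAm hAinv).resolve_left fun h => ?_
    rw [setIntegral_eq_integral_of_ae_compl_eq_zero (h.mono fun x hx hx' => absurd hx hx')] at hA0
    linarith
  refine hnot.mono fun x hx => ?_
  simp only [hA, Set.mem_ofPred_eq, not_forall, not_exists, not_lt] at hx
  obtain ⟨b, hb⟩ := hx
  exact ⟨b, fun n => (birkhoffSum_le_maxSum f n x).trans (hb n)⟩

theorem ae_forall_exists_birkhoffSum_le [IsProbabilityMeasure μ] (hT : Ergodic T μ) {f : α → ℝ}
    (hfm : Measurable f) (hf : Integrable f μ) :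
    ∀ᵐ x ∂μ, ∀ q : ℕ, ∃ b : ℝ, ∀ n,
      birkhoffSum T f n x ≤ n * (∫ x, f x ∂μ + 1 / ((q : ℝ) + 1)) + b := by
  rw [ae_all_iff]
  intro q
  set c := ∫ x, f x ∂μ + 1 / ((q : ℝ) + 1) with hc
  have hq : (0 : ℝ) < 1 / ((q : ℝ) + 1) := by positivity
  have h := ae_exists_birkhoffSum_le hT (f := fun x => f x - c) (hfm.sub_const c)
    (hf.sub (integrable_const c)) (by
      rw [integral_sub hf (integrable_const c), integral_const]
      simp only [probReal_univ, one_smul]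
      linarith)
  refine h.mono fun x ⟨b, hb⟩ => ⟨b, fun n => ?_⟩
  have := hb n
  simp only [birkhoffSum, Finset.sum_sub_distrib, Finset.sum_const, Finset.card_range,
    nsmul_eq_mul] at this ⊢
  linarith

/-- The pointwise ergodic theorem for measurable real functions. -/
theorem ae_tendsto_birkhoffSum_of_measurable [IsProbabilityMeasure μ] (hT : Ergodic T μ)
    {f : α → ℝ} (hfm : Measurable f) (hf : Integrable f μ) :
    ∀ᵐ x ∂μ, Tendsto (fun n : ℕ => birkhoffSum T f n x / n) atTop (𝓝 (∫ x, f x ∂μ)) := by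
  have hn : ∫ x, -f x ∂μ = -∫ x, f x ∂μ := integral_neg f
  filter_upwards [ae_forall_exists_birkhoffSum_le hT hfm hf,
    ae_forall_exists_birkhoffSum_le hT (f := fun x => -f x) hfm.neg hf.neg] with x h1 h2
  rw [Metric.tendsto_atTop]
  intro ε hε
  obtain ⟨q, hq⟩ := exists_nat_one_div_lt (half_pos hε)
  obtain ⟨b, hb⟩ := h1 q
  obtain ⟨b', hb'⟩ := h2 q
  obtain ⟨N, hN⟩ := exists_nat_gt (max b b' / (ε / 2))
  refine ⟨N + 1, fun n hnN => ?_⟩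
  have hn1 : ((N : ℝ) + 1) ≤ n := by exact_mod_cast hnN
  have hn0 : (0 : ℝ) < n := by have : (0 : ℝ) ≤ N := Nat.cast_nonneg N; linarith
  rw [div_lt_iff₀ (half_pos hε)] at hN
  have hb1 : max b b' < n * (ε / 2) := hN.trans_le (by gcongr; linarith)
  have h3 := hb n
  have h4 := hb' n
  rw [hn] at h4
  have h5 : birkhoffSum T (fun x => -f x) n x = -birkhoffSum T f n x := by simp [birkhoffSum]
  rw [h5] at h4
  have hqn : (n : ℝ) * (1 / ((q : ℝ) + 1)) ≤ n * (ε / 2) := by gcongr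
  have hbl := le_max_left b b'
  have hbr := le_max_right b b'
  rw [Real.dist_eq, abs_lt, lt_sub_iff_add_lt, sub_lt_iff_lt_add, lt_div_iff₀ hn0, div_lt_iff₀ hn0]
  constructor <;> nlinarith

/-- The pointwise ergodic theorem: for an ergodic map, time averages of an integrable function
converge to its integral almost everywhere. -/
theorem ae_tendsto_birkhoffSum [IsProbabilityMeasure μ] (hT : Ergodic T μ)
    {f : α → ℝ} (hf : Integrable f μ) :
    ∀ᵐ x ∂μ, Tendsto (fun n : ℕ => birkhoffSum T f n x / n) atTop (𝓝 (∫ x, f x ∂μ)) := by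
  obtain ⟨g, hgm, hfg⟩ := hf.aestronglyMeasurable
  have h1 := ae_tendsto_birkhoffSum_of_measurable hT hgm.measurable (hf.congr hfg)
  have h2 : ∀ᵐ x ∂μ, ∀ n, birkhoffSum T f n x = birkhoffSum T g n x :=
    ae_all_iff.2 fun n =>
      hT.quasiMeasurePreserving.birkhoffSum_ae_eq_of_ae_eq hfg n
  filter_upwards [h1, h2] with x hx1 hx2
  simpa only [hx2, integral_congr_ae hfg] using hx1

/-- The pointwise ergodic theorem for complex functions. -/
theorem ae_tendsto_sum_complex [IsProbabilityMeasure μ] (hT : Ergodic T μ)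
    {f : α → ℂ} (hf : Integrable f μ) :
    ∀ᵐ x ∂μ, Tendsto (fun n : ℕ => (1 / (n : ℂ)) * ∑ i ∈ Finset.range n, f (T^[i] x)) atTop
      (𝓝 (∫ x, f x ∂μ)) := by
  filter_upwards [ae_tendsto_birkhoffSum hT hf.re, ae_tendsto_birkhoffSum hT hf.im] with x h1 h2
  have h3 := ((Complex.continuous_ofReal.tendsto _).comp h1).add
    (((Complex.continuous_ofReal.tendsto _).comp h2).mul_const Complex.I)
  have e : ∫ x, f x ∂μ = ((∫ x, RCLike.re (f x) ∂μ : ℝ) : ℂ) +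
      ((∫ x, RCLike.im (f x) ∂μ : ℝ) : ℂ) * Complex.I :=
    (integral_re_add_im hf).symm
  rw [e]
  refine h3.congr fun n => ?_
  apply Complex.ext
  · simp [birkhoffSum, ← Complex.ofReal_natCast, ← Complex.ofReal_inv, div_eq_inv_mul]
  · simp [birkhoffSum, ← Complex.ofReal_natCast, ← Complex.ofReal_inv, div_eq_inv_mul]

end Birkhoff

/-! ### The hull -/

/-- The word of length `n` that starts at position `k` of a bi-infinite word. -/
def window (x : ℤ → Letter) (k : ℤ) (n : ℕ) : List Letter :=
  List.ofFn fun i : Fin n => x (k + (i : ℕ))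

@[simp]
theorem length_window (x : ℤ → Letter) (k : ℤ) (n : ℕ) : (window x k n).length = n := by
  simp [window]

theorem take_drop_window (x : ℤ → Letter) (k : ℤ) {i n n' : ℕ} (h : i + n ≤ n') :
    ((window x k n').drop i).take n = window x (k + i) n := by
  apply List.ext_getElem
  · simp; omega
  · intro j h1 h2
    simp [window, add_assoc]

theorem window_shift (x : ℤ → Letter) (k : ℤ) (n : ℕ) :
    window (shift x) k n = window x (k + 1) n := by
  simp only [window, shift, Equiv.coe_fn_mk]
  congr 1
  funext i
  congr 1
  ring

theorem continuous_window (k : ℤ) (n : ℕ) : Continuous fun (x : ℤ → Letter) (i : Fin n) =>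
    x (k + (i : ℕ)) :=
  continuous_pi fun _ => continuous_apply _

theorem window_infix (x : ℤ → Letter) {k k' : ℤ} {n n' : ℕ} (h : k' ≤ k) (h' : k + n ≤ k' + n') :
    window x k n <:+: window x k' n' := by
  obtain ⟨i, rfl⟩ := Int.le.dest h
  rw [← take_drop_window x k' (i := i) (n := n) (n' := n') (by omega)]
  exact (List.take_prefix _ _).isInfix.trans (List.drop_suffix _ _).isInfix

theorem aa_legal (hm : 1 ≤ m) : Legal m [Letter.a, Letter.a] := by
  obtain ⟨j, rfl⟩ : ∃ j, m = j + 1 := ⟨m - 1, by omega⟩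
  have h1 : Legal (j + 1) (letterImage (j + 1) Letter.a 0) :=
    legal_of_mem_iterImages (k := 1) ⟨_, rfl, letterImage_mem_images Letter.a 0⟩
  have h2 : Legal (j + 1) ([Letter.b] ++ [Letter.a]) :=
    h1.mono ⟨[], List.replicate j Letter.a, by simp [letterImage, List.replicate_succ]⟩
  have h3 := h2.of_mem_images (append_mem_images (letterImage_mem_images Letter.b 0)
    (letterImage_mem_images Letter.a (Fin.last (j + 1))))
  exact h3.mono ⟨[], List.replicate j Letter.a ++ [Letter.b],
    by simp [letterImage, List.replicate_succ]⟩

/-- The set of bi-infinite words all of whose subwords are legal. -/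
def legalSequences (m : ℕ) : Set (ℤ → Letter) := {x | ∀ k n, Legal m (window x k n)}

theorem isClosed_legalSequences : IsClosed (legalSequences m) := by
  have : legalSequences m = ⋂ (k : ℤ) (n : ℕ),
      (fun (x : ℤ → Letter) (i : Fin n) => x (k + (i : ℕ))) ⁻¹' {w | Legal m (List.ofFn w)} := by
    ext x; simp [legalSequences, window]
  rw [this]
  exact isClosed_iInter fun k => isClosed_iInter fun n =>
    (isClosed_discrete _).preimage (continuous_window k n)

theorem shift_image_legalSequences : shift '' legalSequences m = legalSequences m := by
  ext x
  rw [Equiv.image_eq_preimage_symm]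
  have key (y : ℤ → Letter) : shift y ∈ legalSequences m ↔ y ∈ legalSequences m := by
    simp only [legalSequences, Set.mem_ofPred_eq, window_shift]
    exact ⟨fun h k n => by simpa using h (k - 1) n, fun h k n => h (k + 1) n⟩
  rw [Set.mem_preimage, ← key (shift.symm x), Equiv.apply_symm_apply]

theorem generatingWords_subset (hm : 1 ≤ m) : generatingWords m ⊆ legalSequences m := by
  intro x hx k n
  obtain ⟨K, -, u, hu, v, hv, h⟩ := hx (k.natAbs + n) 0
  set N := k.natAbs + n with hN
  have hl : Legal m (u ++ v) := by
    obtain ⟨j, hj, w, hw, haw⟩ := aa_legal hm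
    obtain ⟨y, hy, huy⟩ := exists_mem_iterImages_infix haw (append_mem_iterImages hu hv)
    exact ⟨j + K, by omega, y, iterImages_trans hw hy, huy⟩
  refine hl.mono ((window_infix x (k' := -N) (n' := N + N) (by omega)
    (by push_cast; omega)).trans ?_)
  have hNv : N ≤ v.length := by
    by_contra! hlt
    obtain ⟨-, h2⟩ := h v.length hlt
    simp at h2
  have hNu : N ≤ u.length := by
    by_contra! hlt
    obtain ⟨h1, -⟩ := h u.length hlt
    simp at h1
  have e : window x (-N) (N + N) = ((u ++ v).drop (u.length - N)).take (N + N) := by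
    apply List.ext_getElem
    · simp; omega
    · intro j h1 h2
      simp only [length_window] at h1
      simp only [window, List.getElem_ofFn, List.getElem_take, List.getElem_drop]
      rcases lt_or_ge j N with hj | hj
      · obtain ⟨h3, -⟩ := h (N - 1 - j) (by omega)
        rw [List.getElem?_reverse (by omega), List.getElem?_eq_getElem (by omega)] at h3
        rw [List.getElem_append_left (by omega)]
        have h4 := Option.some.inj h3
        have h5 : (-1 - ((N - 1 - j : ℕ) : ℤ)) = -N + (j : ℤ) := by omega
        rw [h5] at h4
        rw [← h4]
        congr 1
        omega
      · obtain ⟨-, h3⟩ := h (j - N) (by omega)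
        rw [List.getElem?_eq_getElem (by omega)] at h3
        rw [List.getElem_append_right (by omega)]
        have h4 := Option.some.inj h3
        have h5 : (((j - N : ℕ) : ℤ)) = -N + (j : ℤ) := by omega
        rw [h5] at h4
        rw [← h4]
        congr 1
        omega
  rw [e]
  exact (List.take_prefix _ _).isInfix.trans (List.drop_suffix _ _).isInfix

theorem hull_subset (hm : 1 ≤ m) : hull m ⊆ legalSequences m :=
  Set.sInter_subset_of_mem
    ⟨isClosed_legalSequences, shift_image_legalSequences, generatingWords_subset hm⟩

theorem isClosed_hull : IsClosed (hull m) := isClosed_sInter fun _ h => h.1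

/-- Every image of `a` extends to the right to images of `a` under higher powers. -/
theorem exists_prefix_succ (hm : 1 ≤ m) {k : ℕ} {v : List Letter}
    (hv : v ∈ iterImages m k [Letter.a]) : ∃ v' ∈ iterImages m (k + 1) [Letter.a], v <+: v' := by
  obtain ⟨y, hy⟩ := iterImages_nonempty (m := m) k
    (List.replicate (m - 1) Letter.a ++ [Letter.b])
  refine ⟨v ++ y, (mem_iterImages_succ k _ _).2 ⟨letterImage m Letter.a (Fin.last m),
    letterImage_mem_images _ _, ?_⟩, List.prefix_append _ _⟩
  have e : letterImage m Letter.a (Fin.last m) =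
      [Letter.a] ++ (List.replicate (m - 1) Letter.a ++ [Letter.b]) := by
    obtain ⟨j, rfl⟩ : ∃ j, m = j + 1 := ⟨m - 1, by omega⟩
    simp [letterImage, List.replicate_succ]
  rw [e]
  exact append_mem_iterImages hv hy

/-- Every image of `a` extends to the left to images of `a` under higher powers. -/
theorem exists_suffix_succ (hm : 1 ≤ m) {k : ℕ} {v : List Letter}
    (hv : v ∈ iterImages m k [Letter.a]) : ∃ v' ∈ iterImages m (k + 1) [Letter.a], v <:+ v' := by
  obtain ⟨y, hy⟩ := iterImages_nonempty (m := m) k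
    ([Letter.b] ++ List.replicate (m - 1) Letter.a)
  refine ⟨y ++ v, (mem_iterImages_succ k _ _).2 ⟨letterImage m Letter.a 0,
    letterImage_mem_images _ _, ?_⟩, List.suffix_append _ _⟩
  have e : letterImage m Letter.a 0 =
      ([Letter.b] ++ List.replicate (m - 1) Letter.a) ++ [Letter.a] := by
    obtain ⟨j, rfl⟩ : ∃ j, m = j + 1 := ⟨m - 1, by omega⟩
    simp [letterImage, List.replicate_succ']
  rw [e]
  exact append_mem_iterImages hy hv

/-- A sequence of words, each a prefix of the next, with lengths tending to infinity has a
one-sided infinite limit. -/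
theorem exists_limit_of_prefix {v : ℕ → List Letter} (h : ∀ k, v k <+: v (k + 1))
    (hl : ∀ N, ∃ k, N ≤ (v k).length) :
    ∃ y : ℕ → Letter, ∀ k j, j < (v k).length → (v k)[j]? = some (y j) := by
  have hmono : ∀ k l, k ≤ l → v k <+: v l := fun k l hkl => by
    induction l, hkl using Nat.le_induction with
    | base => exact List.prefix_refl _
    | succ l _ ih => exact ih.trans (h l)
  choose K hK using hl
  refine ⟨fun j => (v (K (j + 1)))[j]'(hK (j + 1)), fun k j hj => ?_⟩
  rw [List.getElem?_eq_getElem hj]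
  rcases le_total k (K (j + 1)) with hk | hk
  · rw [(hmono _ _ hk).getElem hj]
  · exact congrArg some ((hmono _ _ hk).getElem (hK (j + 1))).symm

theorem exists_chain {R : List Letter → List Letter → Prop}
    (h : ∀ k, ∀ v ∈ iterImages m k [Letter.a], ∃ v' ∈ iterImages m (k + 1) [Letter.a], R v v')
    {k : ℕ} {v₀ : List Letter} (h₀ : v₀ ∈ iterImages m k [Letter.a]) :
    ∃ v : ℕ → List Letter, v 0 = v₀ ∧ (∀ n, v n ∈ iterImages m (k + n) [Letter.a]) ∧
      ∀ n, R (v n) (v (n + 1)) := by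
  choose F hF hR using h
  let c : ∀ n, {v // v ∈ iterImages m (k + n) [Letter.a]} := fun n =>
    Nat.rec ⟨v₀, h₀⟩ (fun n v => ⟨F (k + n) v.1 v.2, hF (k + n) v.1 v.2⟩) n
  exact ⟨fun n => (c n).1, rfl, fun n => (c n).2, fun n => hR (k + n) (c n).1 (c n).2⟩

/-- Every legal word occurs in a generating word: an image of `a` that contains it can be extended
to both sides. -/
theorem exists_mem_generatingWords (hm : 1 ≤ m) {u : List Letter} (hu : Legal m u) :
    ∃ x ∈ generatingWords m, ∃ k, window x k u.length = u := by
  obtain ⟨k, hk⟩ := hu.exists_infix hm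
  obtain ⟨v₀, hv₀, s, t, hst⟩ := hk Letter.a
  obtain ⟨v, hv0, hv, hvp⟩ := exists_chain (fun _ _ h => exists_prefix_succ hm h) hv₀
  obtain ⟨w, -, hw, hws⟩ := exists_chain (fun _ _ h => exists_suffix_succ hm h) hv₀
  have hlen : ∀ N K : ℕ, ∃ n, K ≤ k + n ∧ N ≤ inflLen m (k + n) Letter.a := by
    intro N K
    obtain ⟨j, h1, h2⟩ := ((eventually_ge_atTop (max k K)).and
      ((tendsto_inflLen hm).eventually_ge_atTop (N : ℝ))).exists
    obtain ⟨n, rfl⟩ := Nat.exists_eq_add_of_le ((le_max_left _ _).trans h1)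
    exact ⟨n, (le_max_right _ _).trans h1, by exact_mod_cast h2⟩
  have hvl (n : ℕ) : (v n).length = inflLen m (k + n) Letter.a := by
    simpa using length_of_mem_iterImages (hv n)
  have hwl (n : ℕ) : (w n).length = inflLen m (k + n) Letter.a := by
    simpa using length_of_mem_iterImages (hw n)
  obtain ⟨y, hy⟩ := exists_limit_of_prefix hvp fun N => by
    obtain ⟨n, -, h⟩ := hlen N 0
    exact ⟨n, by rwa [hvl]⟩
  obtain ⟨z, hz⟩ := exists_limit_of_prefix (v := fun n => (w n).reverse)
    (fun n => List.reverse_prefix.2 (hws n)) fun N => by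
      obtain ⟨n, -, h⟩ := hlen N 0
      exact ⟨n, by rwa [List.length_reverse, hwl]⟩
  refine ⟨fun i => if 0 ≤ i then y i.toNat else z (-1 - i).toNat, ?_, s.length, ?_⟩
  · intro N K
    obtain ⟨n, h1, h2⟩ := hlen N K
    refine ⟨k + n, h1, w n, hw n, v n, hv n, fun j hj => ⟨?_, ?_⟩⟩
    · rw [hz n j (by rw [List.length_reverse, hwl]; omega)]
      have h3 : ¬ (0 : ℤ) ≤ -1 - j := by omega
      have h4 : (-1 - (-1 - (j : ℤ))).toNat = j := by omega
      simp only [if_neg h3, h4]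
    · rw [hy n j (by rw [hvl]; omega)]
      simp
  · apply List.ext_getElem
    · simp
    · intro j h1 h2
      have h3 := hy 0 (s.length + j) (by rw [hv0, ← hst]; simp; omega)
      rw [hv0, List.getElem?_eq_getElem (by rw [← hst]; simp; omega)] at h3
      have h4 := Option.some.inj h3
      simp only [window, List.getElem_ofFn]
      rw [if_pos (by omega)]
      have h5 : ((s.length : ℤ) + (j : ℤ)).toNat = s.length + j := by omega
      rw [h5, ← h4]
      simp only [← hst]
      rw [List.getElem_append_left (by simp; omega), List.getElem_append_right (by omega)]
      simp

theorem shift_zpow_apply (k : ℤ) (x : ℤ → Letter) (i : ℤ) : (shift ^ k) x i = x (i + k) := by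
  induction k generalizing i with
  | zero => simp
  | succ k ih =>
    rw [add_comm (k : ℤ) 1, zpow_add, zpow_one, Equiv.Perm.mul_apply]
    change (shift ^ (k : ℤ)) x (i + 1) = _
    rw [ih]
    congr 1
    ring
  | pred k ih =>
    rw [sub_eq_neg_add, zpow_add, zpow_neg_one, Equiv.Perm.mul_apply]
    change (shift ^ (-(k : ℤ))) x (i - 1) = _
    rw [ih]
    congr 1
    ring

theorem hullShift_zpow_coe (k : ℤ) (x : hull m) : ((hullShift m ^ k) x).1 = (shift ^ k) x.1 := by
  induction k with
  | zero => rfl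
  | succ k ih =>
    rw [add_comm (k : ℤ) 1, zpow_add, zpow_add, zpow_one, zpow_one, Equiv.Perm.mul_apply,
      Equiv.Perm.mul_apply, ← ih]
    rfl
  | pred k ih =>
    rw [sub_eq_neg_add, zpow_add, zpow_add, zpow_neg_one, zpow_neg_one, Equiv.Perm.mul_apply,
      Equiv.Perm.mul_apply, ← ih]
    rfl

theorem hullShift_zpow_apply (k : ℤ) (x : hull m) (i : ℤ) :
    ((hullShift m ^ k) x).1 i = x.1 (i + k) := by
  rw [hullShift_zpow_coe, shift_zpow_apply]

/-- Every legal word occurs in an element of the hull, at any given position. -/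
theorem exists_mem_hull (hm : 1 ≤ m) {n : ℕ} (u : LegalWord m n) (k : ℤ) :
    ∃ x : hull m, window x.1 k n = List.ofFn u.1 := by
  obtain ⟨x, hx, j, hj⟩ := exists_mem_generatingWords hm u.2
  have hxh : x ∈ hull m := fun Y hY => hY.2.2 hx
  refine ⟨(hullShift m ^ (j - k)) ⟨x, hxh⟩, ?_⟩
  rw [List.length_ofFn] at hj
  rw [← hj]
  simp only [window]
  congr 1
  funext i
  rw [hullShift_zpow_apply]
  exact congrArg x (by ring)

/-! ### Cylinder sets -/

theorem mem_cylinder_iff {k : ℤ} {n : ℕ} {w : Fin n → Letter} {x : hull m} :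
    x ∈ cylinder m k w ↔ window x.1 k n = List.ofFn w := by
  rw [window, List.ofFn_inj, funext_iff]
  rfl

theorem continuous_hull_window (k : ℤ) (n : ℕ) :
    Continuous fun (x : hull m) (i : Fin n) => x.1 (k + (i : ℕ)) :=
  (continuous_window k n).comp continuous_subtype_val

theorem isClopen_cylinder (k : ℤ) {n : ℕ} (w : Fin n → Letter) : IsClopen (cylinder m k w) := by
  have : cylinder m k w = (fun (x : hull m) (i : Fin n) => x.1 (k + (i : ℕ))) ⁻¹' {w} := by
    ext x
    rw [Set.mem_preimage, Set.mem_singleton_iff, funext_iff]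
    rfl
  rw [this]
  exact (isClopen_discrete _).preimage (continuous_hull_window k n)

theorem measurableSet_cylinder (k : ℤ) {n : ℕ} (w : Fin n → Letter) :
    MeasurableSet (cylinder m k w) := (isClopen_cylinder k w).isOpen.measurableSet

theorem continuous_comp_window (f : List Letter → ℝ) (k : ℤ) (n : ℕ) :
    Continuous fun x : hull m => f (window x.1 k n) :=
  (continuous_of_discreteTopology (f := fun w : Fin n → Letter => f (List.ofFn w))).comp
    (continuous_hull_window k n)

instance : CompactSpace (hull m) := isCompact_iff_compactSpace.1 isClosed_hull.isCompact

theorem integrable_comp_window (μ : Measure (hull m)) [IsFiniteMeasure μ] (f : List Letter → ℝ)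
    (k : ℤ) (n : ℕ) : Integrable (fun x : hull m => f (window x.1 k n)) μ :=
  (continuous_comp_window f k n).integrable_of_hasCompactSupport (.of_compactSpace _)

theorem legal_window (hm : 1 ≤ m) (x : hull m) (k : ℤ) (n : ℕ) : Legal m (window x.1 k n) :=
  hull_subset hm x.2 k n

theorem measure_univ_eq_sum (hm : 1 ≤ m) (μ : Measure (hull m)) (k : ℤ) (n : ℕ) :
    μ Set.univ = ∑ w : LegalWord m n, μ (cylinder m k w.1) := by
  rw [← tsum_fintype (L := .unconditional _), ← measure_iUnion]
  · congr 1
    symm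
    rw [Set.eq_univ_iff_forall]
    intro x
    exact Set.mem_iUnion.2 ⟨⟨_, legal_window hm x k n⟩, fun _ => rfl⟩
  · intro v w hvw
    rw [Function.onFun, Set.disjoint_left]
    intro x hv hw
    exact hvw (Subtype.ext (funext fun i => (hv i).symm.trans (hw i)))
  · exact fun w => measurableSet_cylinder k w.1

theorem mem_cylinder_iff_of_mem {N : ℕ} {w : Fin (2 * N + 1) → Letter} {x y : hull m}
    (hx : x ∈ cylinder m (-N) w) :
    y ∈ cylinder m (-N) w ↔ ∀ i : ℤ, i.natAbs ≤ N → y.1 i = x.1 i := by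
  constructor
  · intro hy i hi
    have h1 := hy ⟨(i + N).toNat, by omega⟩
    have h2 := hx ⟨(i + N).toNat, by omega⟩
    have h3 : (-N + ((i + N).toNat : ℕ) : ℤ) = i := by omega
    simp only [h3] at h1 h2
    rw [h1, h2]
  · intro h i
    rw [h _ (by omega)]
    exact hx i

/-- Cylinder sets of words that are centred at the origin. -/
def centredCylinders (m : ℕ) : Set (Set (hull m)) :=
  {s | ∃ (N : ℕ) (w : LegalWord m (2 * N + 1)), s = cylinder m (-N) w.1}

/-- Centred cylinder sets are nested or disjoint. -/
theorem isPiSystem_centredCylinders : IsPiSystem (centredCylinders m) := by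
  have key : ∀ {N N' : ℕ} (w : LegalWord m (2 * N + 1)) (w' : LegalWord m (2 * N' + 1)), N ≤ N' →
      (cylinder m (-N) w.1 ∩ cylinder m (-N') w'.1).Nonempty →
      cylinder m (-N') w'.1 ⊆ cylinder m (-N) w.1 := by
    rintro N N' w w' h ⟨x, hx, hx'⟩ y hy
    rw [mem_cylinder_iff_of_mem hx'] at hy
    rw [mem_cylinder_iff_of_mem hx]
    exact fun i hi => hy i (hi.trans h)
  rintro s ⟨N, w, rfl⟩ t ⟨N', w', rfl⟩ hst
  rcases le_total N N' with h | h
  · rw [Set.inter_eq_right.2 (key w w' h hst)]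
    exact ⟨N', w', rfl⟩
  · rw [Set.inter_comm] at hst
    rw [Set.inter_eq_left.2 (key w' w h hst)]
    exact ⟨N, w, rfl⟩

theorem isTopologicalBasis_centredCylinders (hm : 1 ≤ m) :
    TopologicalSpace.IsTopologicalBasis (centredCylinders m) := by
  refine TopologicalSpace.isTopologicalBasis_of_isOpen_of_nhds ?_ ?_
  · rintro s ⟨N, w, rfl⟩
    exact (isClopen_cylinder _ _).isOpen
  · intro x U hx hU
    obtain ⟨V, hV, rfl⟩ := isOpen_induced_iff.1 hU
    obtain ⟨I, u, hu, hIV⟩ := isOpen_pi_iff.1 hV x.1 hx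
    set N := I.sup Int.natAbs with hN
    have hxc : x ∈ cylinder m (-N) (fun i : Fin (2 * N + 1) => x.1 (-N + (i : ℕ))) := fun _ => rfl
    refine ⟨_, ⟨N, ⟨_, legal_window hm x (-N) (2 * N + 1)⟩, rfl⟩, hxc, fun y hy => hIV ?_⟩
    intro i hi
    have hy' := (mem_cylinder_iff_of_mem hxc).1 hy
    rw [hy' i (Finset.le_sup (f := Int.natAbs) hi)]
    exact (hu i hi).2

/-- A finite measure on the hull is determined by its values on cylinder sets of legal words. -/
theorem ext_of_cylinder (hm : 1 ≤ m) {μ ν : Measure (hull m)} [IsFiniteMeasure μ]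
    (h : ∀ (n : ℕ) [NeZero n] (w : LegalWord m n) (k : ℤ),
      μ (cylinder m k w.1) = ν (cylinder m k w.1)) : μ = ν := by
  refine ext_of_generate_finite (centredCylinders m) ?_ isPiSystem_centredCylinders ?_ ?_
  · rw [← (isTopologicalBasis_centredCylinders hm).borel_eq_generateFrom]
    exact BorelSpace.measurable_eq
  · rintro s ⟨N, w, rfl⟩
    exact h _ w _
  · rw [measure_univ_eq_sum hm μ 0 1, measure_univ_eq_sum hm ν 0 1]
    exact Finset.sum_congr rfl fun w _ => h 1 w 0

/-! ### The frequency measure -/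

theorem preimage_cylinder (k j : ℤ) {n : ℕ} (w : Fin n → Letter) :
    ⇑(hullShift m ^ j) ⁻¹' cylinder m k w = cylinder m (k + j) w := by
  ext x
  simp only [Set.mem_preimage, cylinder, Set.mem_ofPred_eq, hullShift_zpow_apply]
  refine forall_congr' fun i => ?_
  rw [add_right_comm]

theorem measurable_hullShift_zpow (j : ℤ) : Measurable ⇑(hullShift m ^ j) := by
  have : Continuous ⇑(hullShift m ^ j) := by
    refine Continuous.subtype_mk (f := fun x => ((hullShift m ^ j) x).1)
      (continuous_pi fun i => ?_) fun x => ((hullShift m ^ j) x).2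
    simp only [hullShift_zpow_apply]
    exact (continuous_apply _).comp continuous_subtype_val
  exact this.measurable

theorem startsWith_ofFn_drop {n n' i : ℕ} (u : Fin n → Letter) (w : Fin n' → Letter) (x : hull m)
    {k : ℤ} (hx : window x.1 k n' = List.ofFn w) (h : i + n ≤ n') :
    startsWith u ((List.ofFn w).drop i) =
      (cylinder m (k + i) u).indicator (fun _ => (1 : ℝ)) x := by
  rw [← hx, startsWith, take_drop_window x.1 k h]
  by_cases hc : window x.1 (k + i) n = List.ofFn u
  · rw [if_pos hc, Set.indicator_of_mem (mem_cylinder_iff.2 hc)]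
  · rw [if_neg hc, Set.indicator_of_notMem (mt mem_cylinder_iff.1 hc)]

open Classical in
/-- There is a probability measure on the hull with the given cylinder frequencies: a cluster point
of measures with the right values on the cylinder sets of words near the origin. -/
theorem exists_probabilityMeasure (hm : 1 ≤ m) (hp : ∀ i, 0 ≤ p i) (hsum : ∑ i, p i = 1) :
    ∃ μ : ProbabilityMeasure (hull m), ∀ (n : ℕ) (w : LegalWord m n) (k : ℤ),
      (μ : Measure (hull m)) (cylinder m k w.1) = ENNReal.ofReal (freqVec p n w) := by
  choose x hx using fun (N : ℕ) (w : LegalWord m (2 * N + 1)) => exists_mem_hull hm w (-N)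
  have hR0 := fun (N : ℕ) (w : LegalWord m N) => freqVec_nonneg hm hp hsum w
  set ν : ℕ → Measure (hull m) := fun N =>
    ∑ w : LegalWord m (2 * N + 1), ENNReal.ofReal (freqVec p _ w) • Measure.dirac (x N w) with hν
  have hprob (N : ℕ) : IsProbabilityMeasure (ν N) := by
    constructor
    simp only [hν, Measure.coe_finsetSum, Finset.sum_apply, Measure.smul_apply, measure_univ,
      smul_eq_mul, mul_one]
    rw [← ENNReal.ofReal_sum_of_nonneg fun w _ => hR0 _ w, sum_freqVec hm hp hsum,
      ENNReal.ofReal_one]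
  have hcyl (n : ℕ) (u : LegalWord m n) (k : ℤ) (N : ℕ) (hN : k.natAbs + n ≤ N) :
      ν N (cylinder m k u.1) = ENNReal.ofReal (freqVec p n u) := by
    obtain ⟨i, hi⟩ : ∃ i : ℕ, k = -N + i := ⟨(k + N).toNat, by omega⟩
    have h1 : freqVec p n u = ∑ w : LegalWord m (2 * N + 1),
        freqVec p _ w * (cylinder m k u.1).indicator (fun _ => (1 : ℝ)) (x N w) := by
      rw [← wsum_startsWith (freqVec p n) u, ← wsum_freqVec_drop hm hp hsum
        (isLocal_startsWith u.1) (n' := 2 * N + 1) (j := i) (by omega)]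
      refine Finset.sum_congr rfl fun w _ => ?_
      beta_reduce
      rw [startsWith_ofFn_drop (i := i) u.1 w.1 (x N w) (hx N w) (by omega), hi]
    rw [h1, ENNReal.ofReal_sum_of_nonneg fun w _ => mul_nonneg (hR0 _ w)
      (Set.indicator_nonneg (fun _ _ => zero_le_one) _)]
    simp only [hν, Measure.coe_finsetSum, Finset.sum_apply, Measure.smul_apply, smul_eq_mul]
    refine Finset.sum_congr rfl fun w _ => ?_
    rw [ENNReal.ofReal_mul (hR0 _ w), Measure.dirac_apply' _ (measurableSet_cylinder _ _)]
    congr 1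
    simp only [Set.indicator_apply, Pi.one_apply]
    split_ifs <;> simp
  let νP : ℕ → ProbabilityMeasure (hull m) := fun N => ⟨ν N, hprob N⟩
  obtain ⟨μ, -, hμ⟩ := isCompact_univ.ultrafilter_le_nhds ((hyperfilter ℕ).map νP) (by simp)
  have hlim : Tendsto νP (hyperfilter ℕ) (𝓝 μ) := hμ
  refine ⟨μ, fun n w k => ?_⟩
  have h1 := ProbabilityMeasure.tendsto_measure_of_null_frontier_of_tendsto' hlim
    (E := cylinder m k w.1) (by simp [(isClopen_cylinder k w.1).frontier_eq])
  refine tendsto_nhds_unique h1 (tendsto_const_nhds.congr' ?_)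
  have h2 : ∀ᶠ N : ℕ in (hyperfilter ℕ : Filter ℕ), k.natAbs + n ≤ N :=
    Nat.hyperfilter_le_atTop (eventually_ge_atTop _)
  exact h2.mono fun N hN => (hcyl n w k N hN).symm

/-! ### Ergodicity -/

/-- Integrals of functions of a window are sums over the word frequencies. -/
theorem integral_comp_window (hm : 1 ≤ m) (hp : ∀ i, 0 ≤ p i) (hsum : ∑ i, p i = 1)
    {μ : Measure (hull m)} [IsFiniteMeasure μ]
    (hμ : ∀ (n : ℕ) (w : LegalWord m n) (k : ℤ),
      μ (cylinder m k w.1) = ENNReal.ofReal (freqVec p n w)) (f : List Letter → ℝ) (k : ℤ)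
    (n : ℕ) : ∫ x : hull m, f (window x.1 k n) ∂μ = wsum (freqVec p n) f := by
  have e (x : hull m) : f (window x.1 k n) = ∑ w : LegalWord m n,
      (cylinder m k w.1).indicator (fun _ => f (List.ofFn w.1)) x := by
    rw [Fintype.sum_eq_single ⟨_, legal_window hm x k n⟩]
    · have hx : x ∈ cylinder m k fun i : Fin n => x.1 (k + (i : ℕ)) := fun _ => rfl
      exact (Set.indicator_of_mem hx fun _ => f (window x.1 k n)).symm
    · intro w hw
      refine Set.indicator_of_notMem (fun hx => hw (Subtype.ext (funext fun i => ?_))) _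
      exact (hx i).symm
  simp only [e]
  rw [integral_finsetSum _ fun w _ =>
    (integrable_const _).indicator (measurableSet_cylinder k w.1)]
  refine Finset.sum_congr rfl fun w _ => ?_
  rw [integral_indicator_const _ (measurableSet_cylinder k w.1), measureReal_def, hμ,
    ENNReal.toReal_ofReal (freqVec_nonneg hm hp hsum w), smul_eq_mul]

theorem measurePreserving_hullShift_zpow (hm : 1 ≤ m) {μ : Measure (hull m)} [IsFiniteMeasure μ]
    (hμ : ∀ (n : ℕ) (w : LegalWord m n) (k : ℤ),
      μ (cylinder m k w.1) = ENNReal.ofReal (freqVec p n w)) (j : ℤ) :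
    MeasurePreserving ⇑(hullShift m ^ j) μ μ := by
  refine ⟨measurable_hullShift_zpow j, ext_of_cylinder hm fun n _ w k => ?_⟩
  rw [Measure.map_apply (measurable_hullShift_zpow j) (measurableSet_cylinder k w.1),
    preimage_cylinder, hμ, hμ]

theorem hullShift_iterate (i : ℕ) : (⇑(hullShift m))^[i] = ⇑(hullShift m ^ (i : ℤ)) := by
  rw [zpow_natCast, Equiv.Perm.iterate_eq_pow]

/-- An invariant set is independent of every cylinder set, since the averages of the indicator
function of the cylinder set concentrate around its measure. -/
theorem measure_inter_cylinder (hm : 1 ≤ m) (hp : ∀ i, 0 ≤ p i) (hsum : ∑ i, p i = 1)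
    {μ : Measure (hull m)} [IsProbabilityMeasure μ]
    (hμ : ∀ (n : ℕ) (w : LegalWord m n) (k : ℤ),
      μ (cylinder m k w.1) = ENNReal.ofReal (freqVec p n w)) {s : Set (hull m)}
    (hs : MeasurableSet s) (hinv : ⇑(hullShift m) ⁻¹' s = s) {l : ℕ} (w : LegalWord m l) (k : ℤ) :
    μ (cylinder m k w.1 ∩ s) = μ s * μ (cylinder m k w.1) := by
  set ρ := freqVec p l w with hρdef
  have hρ0 : 0 ≤ ρ := freqVec_nonneg hm hp hsum w
  have hg := isLocal_startsWith w.1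
  have hρ : HasFreq p (startsWith w.1) ρ := hg.hasFreq hm hp hsum
  have hreal : μ.real (cylinder m k w.1 ∩ s) = μ.real s * ρ := by
    refine eq_of_forall_dist_le fun η hη => ?_
    obtain ⟨n, hn, hle⟩ := exists_wsum_windowDev_le hm hp hsum hg hρ hη
    rw [← integral_comp_window hm hp hsum hμ _ k] at hle
    have hn0 : (0 : ℝ) < n := by exact_mod_cast hn
    -- the number of occurrences of `w` at the positions `k, …, k + n - 1`
    have hcount (x : hull m) (i : ℕ) (hi : i < n) :
        startsWith w.1 ((window x.1 k (n + l)).drop i) =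
          (cylinder m k w.1).indicator (fun _ => (1 : ℝ)) ((⇑(hullShift m))^[i] x) := by
      rw [show window x.1 k (n + l) = List.ofFn fun i : Fin (n + l) => x.1 (k + (i : ℕ)) from rfl,
        startsWith_ofFn_drop (i := i) w.1 _ x rfl (by omega), ← preimage_cylinder,
        hullShift_iterate]
      rfl
    have hint (i : ℕ) : ∫ x in s, (cylinder m k w.1).indicator (fun _ => (1 : ℝ))
        ((⇑(hullShift m))^[i] x) ∂μ = μ.real (cylinder m k w.1 ∩ s) := by
      have hT : MeasurePreserving (⇑(hullShift m))^[i] μ μ := by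
        rw [hullShift_iterate]; exact measurePreserving_hullShift_zpow hm hμ i
      have hsi : (⇑(hullShift m))^[i] ⁻¹' s = s := by
        rw [Set.preimage_iterate_eq, Function.iterate_fixed hinv]
      have hres := hT.restrict_preimage hs
      rw [hsi] at hres
      have h1 : ∫ x in s, (cylinder m k w.1).indicator (fun _ => (1 : ℝ)) x ∂μ =
          μ.real (cylinder m k w.1 ∩ s) := by
        rw [integral_indicator_const _ (measurableSet_cylinder k w.1), measureReal_restrict_apply
          (measurableSet_cylinder k w.1), smul_eq_mul, mul_one]
      rw [← h1]
      conv_rhs => rw [← hres.map_eq]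
      rw [integral_map hres.measurable.aemeasurable]
      exact (measurable_const.indicator (measurableSet_cylinder k w.1)).aestronglyMeasurable
    have hsumint : ∫ x in s, (∑ i ∈ Finset.range n,
        startsWith w.1 ((window x.1 k (n + l)).drop i) - n * ρ) ∂μ =
        n * (μ.real (cylinder m k w.1 ∩ s) - μ.real s * ρ) := by
      rw [integral_sub, integral_finsetSum]
      · have : ∀ i ∈ Finset.range n,
            ∫ x in s, startsWith w.1 ((window x.1 k (n + l)).drop i) ∂μ =
              μ.real (cylinder m k w.1 ∩ s) := by
          intro i hi
          rw [← hint i]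
          exact integral_congr_ae (Eventually.of_forall fun x =>
            hcount x i (Finset.mem_range.1 hi))
        rw [Finset.sum_congr rfl this, Finset.sum_const, Finset.card_range, nsmul_eq_mul,
          setIntegral_const, smul_eq_mul]
        ring
      · exact fun i _ => integrable_comp_window _ (fun z => startsWith w.1 (z.drop i)) k _
      · exact integrable_comp_window _
          (fun z => ∑ i ∈ Finset.range n, startsWith w.1 (z.drop i)) k _
      · exact integrable_const _
    have hbound : |n * (μ.real (cylinder m k w.1 ∩ s) - μ.real s * ρ)| ≤ η * n := by
      rw [← hsumint]
      refine (abs_integral_le_integral_abs).trans (le_trans ?_ hle)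
      exact setIntegral_le_integral (integrable_comp_window μ (windowDev _ ρ n) k (n + l))
        (Eventually.of_forall fun x => abs_nonneg _)
    rw [abs_mul, Nat.abs_cast, mul_comm] at hbound
    rw [Real.dist_eq]
    exact le_of_mul_le_mul_right hbound hn0
  rw [← ENNReal.toReal_eq_toReal_iff' (measure_ne_top _ _)
    (ENNReal.mul_ne_top (measure_ne_top _ _) (measure_ne_top _ _)), ENNReal.toReal_mul, hμ l w k,
    ENNReal.toReal_ofReal hρ0]
  exact hreal

/-- An invariant set is independent of all cylinder sets, hence of itself. -/
theorem ergodic_hullShift (hm : 1 ≤ m) (hp : ∀ i, 0 ≤ p i) (hsum : ∑ i, p i = 1)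
    {μ : Measure (hull m)} [IsProbabilityMeasure μ]
    (hμ : ∀ (n : ℕ) (w : LegalWord m n) (k : ℤ),
      μ (cylinder m k w.1) = ENNReal.ofReal (freqVec p n w)) : Ergodic ⇑(hullShift m) μ := by
  have hT : MeasurePreserving ⇑(hullShift m) μ μ := by
    simpa using measurePreserving_hullShift_zpow hm hμ 1
  refine ⟨hT, ⟨fun s hs hinv => ?_⟩⟩
  have h1 : μ.restrict s = μ s • μ := ext_of_cylinder hm fun n _ w k => by
    rw [Measure.restrict_apply (measurableSet_cylinder k w.1),
      measure_inter_cylinder hm hp hsum hμ hs hinv, Measure.smul_apply, smul_eq_mul]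
  have h2 : μ s = μ s * μ s := by
    have := congrArg (fun ν : Measure (hull m) => ν s) h1
    simpa using this
  rw [eventuallyConst_set']
  by_cases h0 : μ s = 0
  · exact Or.inl (ae_eq_empty.2 h0)
  · right
    have h3 : μ s = 1 := by
      have h4 : μ s * μ s = μ s * 1 := by rw [mul_one, ← h2]
      exact (ENNReal.mul_right_inj h0 (measure_ne_top _ _)).1 h4
    rw [ae_eq_univ]
    exact (prob_compl_eq_zero_iff hs).2 h3

theorem isCylinderMeasure_iff (hm : 1 ≤ m) (hpos : ∀ i, 0 < p i) (hsum : ∑ i, p i = 1)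
    {μ : Measure (hull m)} [IsProbabilityMeasure μ]
    (hμ : ∀ (n : ℕ) (w : LegalWord m n) (k : ℤ),
      μ (cylinder m k w.1) = ENNReal.ofReal (freqVec p n w)) (ν : Measure (hull m)) :
    IsCylinderMeasure p ν ↔ ν = μ := by
  constructor
  · intro hν
    refine (ext_of_cylinder hm fun n _ w k => ?_).symm
    obtain ⟨R, hR, hRν⟩ := hν n
    rw [hμ, hRν, hR.eq_freqVec hm hpos hsum]
  · rintro rfl n _
    exact ⟨freqVec p n, isPerronVector_freqVec hm hpos hsum n, fun w k => hμ n w k⟩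

end RNMS

theorem mainTheorem1 (m : ℕ) (hm : 1 ≤ m) (p : Fin (m + 1) → ℝ)
    (hpos : ∀ i, 0 < p i) (hsum : ∑ i, p i = 1) :
    ∃ μ : Measure (RNMS.hull m),
      (∀ ν : Measure (RNMS.hull m), RNMS.IsCylinderMeasure p ν ↔ ν = μ) ∧
      IsProbabilityMeasure μ ∧
      MeasurePreserving (RNMS.hullShift m) μ μ ∧
      ∀ f : RNMS.hull m → ℂ, Integrable f μ → ∀ s : ℤ, ∀ᵐ x ∂μ,
        Tendsto
          (fun n : ℕ => (1 / (n : ℂ)) *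
            ∑ i ∈ Finset.Icc s ((n : ℤ) + s - 1), f ((RNMS.hullShift m ^ i) x))
          atTop (𝓝 (∫ y, f y ∂μ)) := by
  have hp := fun i => (hpos i).le
  obtain ⟨μ, hμ⟩ := RNMS.exists_probabilityMeasure hm hp hsum
  have herg := RNMS.ergodic_hullShift hm hp hsum hμ
  refine ⟨μ, RNMS.isCylinderMeasure_iff hm hpos hsum hμ, inferInstance, herg.toMeasurePreserving,
    fun f hf s => ?_⟩
  -- the averages that start at `s` are the averages that start at `0`, evaluated at `S ^ s x`
  have h := (RNMS.measurePreserving_hullShift_zpow hm hμ s).quasiMeasurePreserving.ae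
    (RNMS.ae_tendsto_sum_complex herg hf)
  refine h.mono fun x hx => hx.congr fun n => ?_
  congr 1
  refine Finset.sum_bij (fun (i : ℕ) _ => s + (i : ℤ)) (fun i hi => ?_) (fun i _ j _ hij => ?_)
    (fun j hj => ?_) fun i _ => ?_
  · rw [Finset.mem_range] at hi
    rw [Finset.mem_Icc]
    omega
  · omega
  · rw [Finset.mem_Icc] at hj
    exact ⟨(j - s).toNat, Finset.mem_range.2 (by omega), by omega⟩
  · rw [RNMS.hullShift_iterate, ← Equiv.Perm.mul_apply, ← zpow_add, add_comm]
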